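/- Let $\mathcal X$ be a finite set of actions, let $\mu(s)=(1+e^{-s})^{-1}$, and let $\lambda,B>0$, $\delta\in(0,1)$. Then there is $T_0\ge 1$, depending only on $\mathcal X,\lambda,B,\delta$, such that the following holds for every horizon $T\ge T_0$. Setting. Let $k\le 1$ be a positive semidefinite kernel on $\mathcal X$ with reproducing kernel Hilbert space $\mathcal H_k$, let $f\in\mathcal H_k$ with $\|f\|_{\mathcal H_k}\le B$, let $x^\star\in\arg\max_{\mathcal X} f$, and put $\mathbb P(x\succ x')=\mu(f(x)-f(x'))$. Let $$\mathbb k\big((x_1,x_1'),(x_2,x_2')\big)=k(x_1,x_2)+k(x_1',x_2')-k(x_1,x_2')-k(x_1',x_2),$$ let $\mathcal H_{\mathbb k}$ be its reproducing kernel Hilbert space, and $$\kappa=\sup_{x,x'}\frac1{\dot\mu(f(x)-f(x'))},\quad L=\max_{x,x'}\dot\mu(f(x)-f(x')),\quad \kappa_1=\kappa,\quad \kappa_r=6\ (r>1),$$ $$\Gamma_a(T)=\max_{z_1,\dots,z_T\in\mathcal X\times\mathcal X}\tfrac12\log\det\big(I+a^{-1}[\mathbb k(z_i,z_j)]_{i,j}\big),\quad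 C=2\sqrt{\frac{2}{\log(1+4(6\lambda)^{-1})}},$$ $$\beta_{(r)}(\delta)=L\Big(B+\sqrt{\tfrac{\kappa_r}{\lambda}\log\tfrac{2R|\mathcal X|}{\delta}}\Big).$$ Algorithm (MR-LPF). The rounds have sizes $N_1=\lceil\sqrt T\rceil$ and $N_r=\min\{\lceil\sqrt{N_{r-1}T}\rceil,\,T-t_{r-1}\}$ for $r>1$, where $t_r=N_1+\dots+N_r$, and $R$ is the first $r$ with $t_r=T$. Start with $\mathcal M_1=\mathcal X$. In round $r$, for $n=1,\dots,N_r$, query a pair $z_{(n,r)}\in\mathcal M_r\times\mathcal M_r$ that maximizes $\sigma_{(n-1,r)}$ over $\mathcal M_r\times\mathcal M_r$, with ties broken arbitrarily but without using the feedback of the current round, where $$\sigma_{(n,r)}^2(z)=\mathbb k(z,z)-\mathbb k_n(z)^\top(\mathbb K_n+\lambda\kappa_r I)^{-1}\mathbb k_n(z),$$ with $\mathbb K_n=[\mathbb k(z_{(i,r)},z_{(j,r)})]_{i,j\le n}$ and $\mathbb k_n(z)=[\mathbb k(z,z_{(i,r)})]_{i\le n}$. Given the past, the answer $y_{(n,r)}\in\{0,1\}$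 to the query $z_{(n,r)}=(x,x')$ is Bernoulli with parameter $\mathbb P(x\succ x')$. At the end of round $r$ let $h_r$ be the minimizer over $g\in\mathcal H_{\mathbb k}$ of $$\sum_{n\le N_r}\Big[-y_{(n,r)}\log\mu\big(g(z_{(n,r)})\big)-(1-y_{(n,r)})\log\big(1-\mu(g(z_{(n,r)}))\big)\Big]+\tfrac\lambda2\|g\|_{\mathcal H_{\mathbb k}}^2,$$ and let $$\mathcal M_{r+1}=\big\{x\in\mathcal M_r:\ \mu(h_r(x,x'))+\beta_{(r)}(\delta)\,\sigma_{(N_r,r)}(x,x')\ge\tfrac12\ \text{ for all }x'\in\mathcal M_r\big\}.$$ Claim. With probability at least $1-\delta$, every $\hat x_T\in\mathcal M_{R+1}$ satisfies $$\mathbb P(x^\star\succ\hat x_T)-\frac12\ \le\ 2\,\beta_{(R)}(\delta)\,C\,\sqrt{\frac{R\,\Gamma_{4\lambda}(T)}{T}} .$$ -/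

import Mathlib

open MeasureTheory ProbabilityTheory

noncomputable section

namespace BOHF

/-! ### Link function, utilities and kernels -/

/-- Bradley-Terry-Luce preference probability `ℙ(x ≻ x') = μ(u x - u x')` for the utility `u`,
where `μ` is the sigmoid. -/
def prefProb {X : Type*} (u : X → ℝ) (x x' : X) : ℝ :=
  Real.sigmoid (u x - u x')

/-- `κ = sup_{x, x'} 1 / μ'(u x - u x')`. -/
def curvature {X : Type*} (u : X → ℝ) : ℝ :=
  ⨆ p : X × X, 1 / deriv Real.sigmoid (u p.1 - u p.2)

/-- `L = max_{x, x'} μ'(u x - u x')`. -/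
def linkSlope {X : Type*} (u : X → ℝ) : ℝ :=
  ⨆ p : X × X, deriv Real.sigmoid (u p.1 - u p.2)

/-- The real-valued kernel `k(x, y)` of a reproducing kernel Hilbert space of real functions. -/
def realKernel (H : Type*) {X : Type*} [NormedAddCommGroup H] [InnerProductSpace ℝ H]
    [CompleteSpace H] [RKHS ℝ H X ℝ] (x y : X) : ℝ :=
  RKHS.kernel H x y 1

/-- The dueling kernel on pairs of actions. -/
def duelingKernel {X : Type*} (k : X → X → ℝ) (z w : X × X) : ℝ :=
  k z.1 w.1 + k z.2 w.2 - k z.1 w.2 - k z.2 w.1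

/-- Gram matrix of a kernel `q` on pairs of actions at the points `pts`. -/
def gram {X : Type*} (q : X × X → X × X → ℝ) {n : ℕ} (pts : Fin n → X × X) :
    Matrix (Fin n) (Fin n) ℝ :=
  Matrix.of fun i j => q (pts i) (pts j)

/-- Uncertainty `σ(w)` given the query points `pts`, with ridge parameter `a`:
`σ²(w) = q(w, w) - q_n(w)ᵀ (K_n + a I)⁻¹ q_n(w)`. -/
def uncertainty {X : Type*} (q : X × X → X × X → ℝ) (a : ℝ) {n : ℕ} (pts : Fin n → X × X)
    (w : X × X) : ℝ :=
  √(q w w - (fun i => q w (pts i)) ⬝ᵥ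
    (((gram q pts + a • (1 : Matrix (Fin n) (Fin n) ℝ))⁻¹).mulVec fun i => q w (pts i)))

/-- Maximum information gain
`Γ_a(T) = max over T query points of (1/2) log det (I + a⁻¹ K_T)`. -/
def maxInfoGain {X : Type*} (q : X × X → X × X → ℝ) (a : ℝ) (T : ℕ) : ℝ :=
  ⨆ pts : Fin T → X × X,
    1 / 2 * Real.log (((1 : Matrix (Fin T) (Fin T) ℝ) + a⁻¹ • gram q pts).det)

/-- Regularized negative log-likelihood of `g` in the RKHS `D` of functions on pairs of actions,
given the query points `pts` and the binary feedback `obs`. -/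
def logisticLoss {X D : Type*} [NormedAddCommGroup D] [InnerProductSpace ℝ D]
    [RKHS ℝ D (X × X) ℝ] (lam : ℝ) {n : ℕ} (pts : Fin n → X × X) (obs : Fin n → Bool)
    (g : D) : ℝ :=
  (∑ i, (if obs i = true then - Real.log (Real.sigmoid (g (pts i)))
    else - Real.log (1 - Real.sigmoid (g (pts i))))) + lam / 2 * ‖g‖ ^ 2

/-! ### Round schedule -/

/-- `(N_r, t_r)`: size of round `r` and number of samples at the end of round `r`, for the
horizon `T`. The entry at `r = 0` only starts the recursion, so that `N_1 = ⌈√T⌉`. As soon as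
the horizon cuts a round short one has `t_r = T`, so only the last round can be cut short. -/
def schedule (T : ℕ) : ℕ → ℕ × ℕ
  | 0 => (1, 0)
  | r + 1 =>
    (min ⌈√(((schedule T r).1 : ℝ) * (T : ℝ))⌉₊ (T - (schedule T r).2),
      (schedule T r).2 + min ⌈√(((schedule T r).1 : ℝ) * (T : ℝ))⌉₊ (T - (schedule T r).2))

/-- The size `N_r` of round `r`. -/
def roundSize (T r : ℕ) : ℕ := (schedule T r).1

/-- The time step `t_r` at the end of round `r`. -/
def roundEnd (T r : ℕ) : ℕ := (schedule T r).2

/-- The number `R` of rounds: the first `r` with `t_r = T`. -/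
def numRounds (T : ℕ) : ℕ := sInf {r | roundEnd T r = T}

/-! ### Parameters of the algorithm -/

/-- `κ_1 = κ` and `κ_r = 6` for `r > 1`. -/
def roundCurvature {X : Type*} (u : X → ℝ) (r : ℕ) : ℝ :=
  if r = 1 then curvature u else 6

/-- `β_(r)(δ) = L (B + √((κ_r / λ) log (2 R |X| / δ)))`. -/
def confWidth {X : Type*} [Fintype X] (u : X → ℝ) (lam B δ : ℝ) (T r : ℕ) : ℝ :=
  linkSlope u * (B + √(roundCurvature u r / lam *
    Real.log (2 * (numRounds T : ℝ) * (Fintype.card X : ℝ) / δ)))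

/-- `C = 2 √(2 / log (1 + 4 (6 λ)⁻¹))`. -/
def constC (lam : ℝ) : ℝ :=
  2 * √(2 / Real.log (1 + 4 * (6 * lam)⁻¹))

/-! ### Feedback model and algorithm -/

/-- The query `z s` and the feedback `y s` of step `s + 1`, for `s < T`: given the past `ℱ s`,
which determines the query, the feedback is Bernoulli with the preference probability of the
queried pair. -/
structure IsBTLFeedback {X Ω : Type*} {mΩ : MeasurableSpace Ω} (P : Measure Ω)
    (ℱ : Filtration ℕ mΩ) (u : X → ℝ) (T : ℕ) (z : ℕ → Ω → X × X) (y : ℕ → Ω → Bool) :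
    Prop where
  query_meas : ∀ s < T, ∀ p : X × X, MeasurableSet[ℱ s] {ω | z s ω = p}
  feedback_meas : ∀ s < T, MeasurableSet[ℱ (s + 1)] {ω | y s ω = true}
  cond_law : ∀ s < T, P[fun ω => if y s ω = true then (1 : ℝ) else 0 | ℱ s]
    =ᵐ[P] fun ω => prefProb u (z s ω).1 (z s ω).2

/-- The first `n` queries of round `r`. -/
def roundQueries {X Ω : Type*} (T r n : ℕ) (z : ℕ → Ω → X × X) (ω : Ω) : Fin n → X × X :=
  fun i => z (roundEnd T (r - 1) + i) ω

/-- The first `n` feedback values of round `r`. -/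
def roundFeedback {Ω : Type*} (T r n : ℕ) (y : ℕ → Ω → Bool) (ω : Ω) : Fin n → Bool :=
  fun i => y (roundEnd T (r - 1) + i) ω

/-- The uncertainty `σ_(n,r)` from the first `n` samples of round `r`, with ridge `λ κ_r`. -/
def roundUncertainty {X Ω : Type*} (q : X × X → X × X → ℝ) (u : X → ℝ) (lam : ℝ) (T r n : ℕ)
    (z : ℕ → Ω → X × X) (ω : Ω) (w : X × X) : ℝ :=
  uncertainty q (lam * roundCurvature u r) (roundQueries T r n z ω) w

/-- `z`, `y` are the queries and the feedback of a run of MR-LPF, `M r` is the set of actions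
retained at the start of round `r`, and `h r` is the prediction at the end of round `r`; `D` is
the RKHS of the dueling kernel.
Ties in the selection are broken arbitrarily, but without using the feedback of the current
round: the queries of a round are determined by the information available at its start. -/
structure IsMRLPF {X Ω D : Type*} [Fintype X] [NormedAddCommGroup D] [InnerProductSpace ℝ D]
    [CompleteSpace D] [RKHS ℝ D (X × X) ℝ] {mΩ : MeasurableSpace Ω} (ℱ : Filtration ℕ mΩ)
    (u : X → ℝ) (lam B δ : ℝ) (T : ℕ) (z : ℕ → Ω → X × X) (y : ℕ → Ω → Bool)
    (M : ℕ → Ω → Set X) (h : ℕ → Ω → D) : Prop where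
  init : ∀ ω, M 1 ω = Set.univ
  select_meas : ∀ r, 1 ≤ r → r ≤ numRounds T → ∀ n < roundSize T r, ∀ p : X × X,
    MeasurableSet[ℱ (roundEnd T (r - 1))] {ω | z (roundEnd T (r - 1) + n) ω = p}
  select : ∀ r, 1 ≤ r → r ≤ numRounds T → ∀ n < roundSize T r, ∀ ω, (M r ω).Nonempty →
    z (roundEnd T (r - 1) + n) ω ∈ M r ω ×ˢ M r ω ∧
    IsMaxOn (roundUncertainty (realKernel D) u lam T r n z ω) (M r ω ×ˢ M r ω)
      (z (roundEnd T (r - 1) + n) ω)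
  predict : ∀ r, 1 ≤ r → r ≤ numRounds T → ∀ ω,
    IsMinOn (logisticLoss (D := D) lam (roundQueries T r (roundSize T r) z ω)
      (roundFeedback T r (roundSize T r) y ω)) Set.univ (h r ω)
  update : ∀ r, 1 ≤ r → r ≤ numRounds T → ∀ ω,
    M (r + 1) ω = {x ∈ M r ω | ∀ x' ∈ M r ω,
      1 / 2 ≤ Real.sigmoid (h r ω (x, x')) + confWidth u lam B δ T r *
        roundUncertainty (realKernel D) u lam T r (roundSize T r) z ω (x, x')}

end BOHF

end

namespace BOHF

/-! In every sufficiently long round, the estimate `h r` predicts the preference probability of each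
pair `(xstar, x)` up to `confWidth` times the uncertainty of that pair. Then `xstar` survives the
elimination, and each survivor, having been compared with `xstar`, is worse by at most twice this
error (`IsMRLPF.elimination`). One of the last two rounds has at least `T / R` samples, and there
maximum-uncertainty sampling bounds the uncertainty by the information gain
(`uncertainty_sq_le_infoGain`).

The sharp confidence bound comes from linearization. The utility difference is a function `g` in the
RKHS of the dueling kernel with norm at most `B` (`exists_difference_function`). Let `v` represent
evaluation at `w` for the design weighted by the true slopes `μ'(g)`. Optimality of the estimate `h`
then splits `h w - g w` into a noise sum with weights `v`, a bias `-λ⟨g, v⟩`, and a remainder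
quadratic in `h - g` (`mle_error_refined`). The weights depend on the queries alone, and these are
fixed before the feedback of the round, so Hoeffding's inequality needs a union only over the rounds
and the pairs `(xstar, x)`; this gives `log (2 R |X| / δ)`.

The remainder needs only a crude estimate of `h - g` at the queries, of logarithmic size `K`
(`mle_error_rough`), obtained by grouping equal queries. A pigeonhole argument makes the uncertainty
at the queries of order `1 / √m`, with `m` a multiple of `√T`, so the remainder is of relative size
`K² / √m`. For large `T` it fits into the slack that the Bernoulli variance bound leaves in
`confWidth`.

The curvature `κ` is paid in the first round only: after it the survivors are within `0.28` of
`xstar` in preference probability, so the slope on surviving pairs is at least `1 / 6`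
(`one_sixth_le_deriv_sigmoid`), which justifies `κ_r = 6`. -/

/-! ### The sigmoid link, the constants `κ` and `L`, and a Bernoulli moment bound -/

theorem deriv_sigmoid_apply (s : ℝ) :
    deriv Real.sigmoid s = Real.sigmoid s * (1 - Real.sigmoid s) := by
  rw [Real.deriv_sigmoid]

theorem deriv_sigmoid_pos (s : ℝ) : 0 < deriv Real.sigmoid s := by
  rw [deriv_sigmoid_apply]
  exact mul_pos (Real.sigmoid_pos s) (sub_pos.2 (Real.sigmoid_lt_one s))

theorem deriv_sigmoid_le (s : ℝ) : deriv Real.sigmoid s ≤ 1 / 4 := by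
  rw [deriv_sigmoid_apply]
  nlinarith [sq_nonneg (Real.sigmoid s - 1 / 2)]

theorem deriv_sigmoid_zero : deriv Real.sigmoid 0 = 1 / 4 := by
  rw [deriv_sigmoid_apply, Real.sigmoid_zero]; norm_num

/-- The hypothesis traps the sigmoid of `s` between `1 - p` and `p`, where `p` is the sigmoid of
`t`, and `x (1 - x)` is smallest at the ends of such an interval. -/
theorem deriv_sigmoid_anti {s t : ℝ} (h : |s| ≤ t) :
    deriv Real.sigmoid t ≤ deriv Real.sigmoid s := by
  rw [deriv_sigmoid_apply, deriv_sigmoid_apply]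
  have h1 := Real.sigmoid_le (abs_le.1 h).1
  have h2 := Real.sigmoid_le (abs_le.1 h).2
  rw [Real.sigmoid_neg] at h1
  nlinarith

theorem exists_deriv_sigmoid_eq_slope (a b : ℝ) :
    ∃ ξ ∈ Set.uIcc a b,
      Real.sigmoid a - Real.sigmoid b = deriv Real.sigmoid ξ * (a - b) := by
  have key : ∀ c d : ℝ, c < d → ∃ ξ ∈ Set.Icc c d,
      Real.sigmoid d - Real.sigmoid c = deriv Real.sigmoid ξ * (d - c) := by
    intro c d hcd
    obtain ⟨ξ, hξ, h⟩ := exists_deriv_eq_slope Real.sigmoid hcd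
      continuous_sigmoid.continuousOn differentiable_sigmoid.differentiableOn
    refine ⟨ξ, Set.Ioo_subset_Icc_self hξ, ?_⟩
    rw [h]
    field_simp [(sub_pos.2 hcd).ne']
  rcases lt_trichotomy a b with h | h | h
  · obtain ⟨ξ, hξ, e⟩ := key a b h
    exact ⟨ξ, by rwa [Set.uIcc_of_le h.le], by linarith⟩
  · subst h
    exact ⟨a, by simp, by simp⟩
  · obtain ⟨ξ, hξ, e⟩ := key b a h
    exact ⟨ξ, by rwa [Set.uIcc_of_ge h.le], e⟩

theorem abs_sigmoid_sub_le (a b : ℝ) :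
    |Real.sigmoid a - Real.sigmoid b| ≤ 1 / 4 * |a - b| := by
  obtain ⟨ξ, -, h⟩ := exists_deriv_sigmoid_eq_slope a b
  rw [h, abs_mul, abs_of_pos (deriv_sigmoid_pos ξ)]
  exact mul_le_mul_of_nonneg_right (deriv_sigmoid_le ξ) (abs_nonneg _)

theorem abs_deriv_sigmoid_sub_le (a b : ℝ) :
    |deriv Real.sigmoid a - deriv Real.sigmoid b| ≤ |a - b| := by
  rw [deriv_sigmoid_apply, deriv_sigmoid_apply]
  have e : Real.sigmoid a * (1 - Real.sigmoid a) - Real.sigmoid b * (1 - Real.sigmoid b)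
      = (Real.sigmoid a - Real.sigmoid b) * (1 - Real.sigmoid a - Real.sigmoid b) := by ring
  rw [e, abs_mul]
  have h1 := abs_sigmoid_sub_le a b
  have h2 : |1 - Real.sigmoid a - Real.sigmoid b| ≤ 1 := by
    rw [abs_le]
    constructor <;> linarith [Real.sigmoid_pos a, Real.sigmoid_pos b, Real.sigmoid_lt_one a,
      Real.sigmoid_lt_one b]
  nlinarith [abs_nonneg (a - b), abs_nonneg (Real.sigmoid a - Real.sigmoid b)]

/-- The secant slope of the sigmoid is close to its derivative. -/
theorem exists_sigmoid_slope (a b : ℝ) :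
    ∃ α, Real.sigmoid a - Real.sigmoid b = α * (a - b) ∧
      |α - deriv Real.sigmoid b| ≤ |a - b| := by
  obtain ⟨ξ, hξ, h⟩ := exists_deriv_sigmoid_eq_slope a b
  refine ⟨_, h, (abs_deriv_sigmoid_sub_le ξ b).trans ?_⟩
  rw [abs_sub_comm ξ]
  exact (Set.abs_sub_right_of_mem_uIcc hξ).trans_eq (abs_sub_comm _ _)

/-- Strong monotonicity of the sigmoid on a bounded range, with linear growth beyond it. -/
theorem sigmoid_sub_mul_ge {a b s c ρ : ℝ} (hb : |b| ≤ s) (hc0 : 0 ≤ c)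
    (hc : c ≤ deriv Real.sigmoid (s + 1)) (hρ : 1 ≤ ρ) (hab : |a - b| ≤ ρ) :
    c / ρ * (a - b) ^ 2 ≤ (Real.sigmoid a - Real.sigmoid b) * (a - b) := by
  have local_bound : ∀ x : ℝ, |x - b| ≤ 1 → ∃ α, c ≤ α ∧
      Real.sigmoid x - Real.sigmoid b = α * (x - b) := by
    intro x hx
    obtain ⟨ξ, hξ, h⟩ := exists_deriv_sigmoid_eq_slope x b
    refine ⟨_, hc.trans (deriv_sigmoid_anti ?_), h⟩
    have h1 : |ξ - b| ≤ |x - b| := by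
      rw [abs_sub_comm ξ]
      exact (Set.abs_sub_right_of_mem_uIcc hξ).trans_eq (abs_sub_comm _ _)
    calc |ξ| = |b + (ξ - b)| := by ring_nf
      _ ≤ |b| + |ξ - b| := abs_add_le _ _
      _ ≤ s + 1 := by linarith
  have hcρ : c / ρ ≤ c := div_le_self hc0 hρ
  have hcρ0 : 0 ≤ c / ρ := by positivity
  rcases le_or_gt |a - b| 1 with h1 | h1
  · obtain ⟨α, hα, h⟩ := local_bound a h1
    rw [h]
    nlinarith [sq_nonneg (a - b)]
  · have hmul : c / ρ * (a - b) ^ 2 ≤ c * |a - b| := by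
      have : c / ρ * |a - b| ≤ c := by
        calc c / ρ * |a - b| ≤ c / ρ * ρ := mul_le_mul_of_nonneg_left hab hcρ0
          _ = c := by field_simp
      rw [← sq_abs]
      nlinarith [abs_nonneg (a - b)]
    -- Farther than distance one, monotonicity keeps the increment gained at `b + 1` or `b - 1`; the
    -- resulting linear growth is why only `c / ρ` survives.
    refine hmul.trans ?_
    rcases lt_abs.1 h1 with h2 | h2
    · obtain ⟨α, hα, h⟩ := local_bound (b + 1) (by simp)
      have := Real.sigmoid_le (show b + 1 ≤ a by linarith)
      rw [abs_of_pos (by linarith)]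
      exact mul_le_mul_of_nonneg_right (by linarith) (by linarith)
    · obtain ⟨α, hα, h⟩ := local_bound (b - 1) (by simp)
      have := Real.sigmoid_le (show a ≤ b - 1 by linarith)
      rw [abs_of_neg (by linarith)]
      nlinarith

theorem curvature_bddAbove {X : Type*} [Finite X] (u : X → ℝ) :
    BddAbove (Set.range fun p : X × X => 1 / deriv Real.sigmoid (u p.1 - u p.2)) :=
  (Set.finite_range _).bddAbove

theorem one_div_curvature_le {X : Type*} [Finite X] (u : X → ℝ) (x x' : X) :
    1 / curvature u ≤ deriv Real.sigmoid (u x - u x') := by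
  have h := le_ciSup (curvature_bddAbove u) (x, x')
  exact (one_div_le (deriv_sigmoid_pos _) (lt_of_lt_of_le
    (one_div_pos.2 (deriv_sigmoid_pos _)) h)).1 h

theorem four_le_curvature {X : Type*} [Finite X] [Nonempty X] (u : X → ℝ) :
    4 ≤ curvature u := by
  obtain ⟨x⟩ := ‹Nonempty X›
  have h := le_ciSup (curvature_bddAbove u) (x, x)
  simp only [sub_self, deriv_sigmoid_zero] at h
  refine le_trans (by norm_num) h

/-- With `b = 2 * B` this bounds `κ` uniformly over the utilities, as is needed for a threshold on
`T` that does not depend on `f`. -/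
theorem curvature_le {X : Type*} [Nonempty X] (u : X → ℝ) {b : ℝ}
    (hb : ∀ x x', |u x - u x'| ≤ b) : curvature u ≤ 1 / deriv Real.sigmoid b :=
  ciSup_le fun _ => one_div_le_one_div_of_le (deriv_sigmoid_pos b) (deriv_sigmoid_anti (hb _ _))

/-- The diagonal pairs attain the global maximum of the slope, so `L` is also a Lipschitz constant
of the sigmoid on all of `ℝ`. -/
theorem linkSlope_eq {X : Type*} [Nonempty X] (u : X → ℝ) : linkSlope u = 1 / 4 := by
  refine le_antisymm (ciSup_le fun _ => deriv_sigmoid_le _) ?_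
  obtain ⟨x⟩ := ‹Nonempty X›
  have h := le_ciSup (f := fun p : X × X => deriv Real.sigmoid (u p.1 - u p.2))
    ⟨1 / 4, by rintro _ ⟨p, rfl⟩; exact deriv_sigmoid_le _⟩ (x, x)
  simp only [sub_self, deriv_sigmoid_zero] at h
  exact h

/-- Hoeffding's lemma for a Bernoulli variable. -/
theorem bernoulli_mgf_le {p : ℝ} (hp0 : 0 ≤ p) (hp1 : p ≤ 1) (w : ℝ) :
    p * Real.exp (w * (1 - p)) + (1 - p) * Real.exp (-(w * p)) ≤ Real.exp (w ^ 2 / 8) := by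
  set ν : Measure ℝ := ENNReal.ofReal p • Measure.dirac 1 + ENNReal.ofReal (1 - p) • Measure.dirac 0
    with hν
  have hprob : IsProbabilityMeasure ν := ⟨by
    simp [hν, ← ENNReal.ofReal_add hp0 (sub_nonneg.2 hp1)]⟩
  have hint : ∀ g : ℝ → ℝ, ∫ x, g x ∂ν = p * g 1 + (1 - p) * g 0 := by
    intro g
    rw [hν, integral_add_measure, integral_smul_measure, integral_smul_measure, integral_dirac,
      integral_dirac, ENNReal.toReal_ofReal hp0, ENNReal.toReal_ofReal (sub_nonneg.2 hp1)]
    · rfl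
    all_goals exact (integrable_dirac (by simp)).smul_measure (by simp)
  have h := hasSubgaussianMGF_of_mem_Icc (μ := ν) (X := id) (a := 0) (b := 1)
    aemeasurable_id (by
      rw [hν, ae_add_measure_iff]
      constructor <;> refine Measure.ae_smul_measure ?_ _ <;> simp [ae_dirac_eq])
  have h2 := h.mgf_le w
  rw [mgf, hint] at h2
  simp only [id, hint] at h2
  convert h2 using 2
  · congr 2; ring
  · congr 2; ring
  · simp; ring

/-! ### Ridge regression and posterior uncertainty in feature space -/

/-- The regularized normal equations `(∑ φᵢ ⊗ φᵢ + a) e = a x`, solved through the Gram matrix. -/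
theorem ridge_normal_eq {E : Type*} [NormedAddCommGroup E] [InnerProductSpace ℝ E] {n : ℕ}
    (φ : Fin n → E) (x : E) {a : ℝ} (ha : 0 < a) (G : Matrix (Fin n) (Fin n) ℝ)
    (hG : ∀ i j, G i j = inner ℝ (φ i) (φ j)) (c : Fin n → ℝ)
    (hc : c = ((G + a • (1 : Matrix (Fin n) (Fin n) ℝ))⁻¹).mulVec fun i => inner ℝ (φ i) x)
    (g : E) :
    ∑ i, inner ℝ (φ i) (x - ∑ j, c j • φ j) * inner ℝ (φ i) g +
      a * inner ℝ (x - ∑ j, c j • φ j) g = a * inner ℝ x g := by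
  have hGram : G = Matrix.gram ℝ φ := by
    ext i j; rw [hG, Matrix.gram_apply]
  have hpd : (G + a • (1 : Matrix (Fin n) (Fin n) ℝ)).PosDef := by
    rw [hGram]
    exact Matrix.PosDef.posSemidef_add (Matrix.posSemidef_gram ℝ φ)
      (Matrix.PosDef.one.smul ha)
  have hdet : IsUnit (G + a • (1 : Matrix (Fin n) (Fin n) ℝ)).det :=
    (Matrix.isUnit_iff_isUnit_det _).1 hpd.isUnit
  have hsol : (G + a • (1 : Matrix (Fin n) (Fin n) ℝ)).mulVec c = fun i => inner ℝ (φ i) x := by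
    rw [hc, Matrix.mulVec_mulVec, Matrix.mul_nonsing_inv _ hdet, Matrix.one_mulVec]
  -- The Gram system `(G + a) c = (⟨φ i, x⟩)` says exactly that the residual has inner products `a *
  -- c i` with the features.
  have hres : ∀ i, inner ℝ (φ i) (x - ∑ j, c j • φ j) = a * c i := by
    intro i
    have h := congrFun hsol i
    rw [Matrix.add_mulVec, Matrix.smul_mulVec, Matrix.one_mulVec] at h
    simp only [Pi.add_apply, Pi.smul_apply, smul_eq_mul, Matrix.mulVec, dotProduct, hG] at h
    rw [inner_sub_right, inner_sum, ← h]
    have : ∑ j, inner ℝ (φ i) (c j • φ j) = ∑ j, inner ℝ (φ i) (φ j) * c j :=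
      Finset.sum_congr rfl fun j _ => by rw [inner_smul_right, mul_comm]
    rw [this]; ring
  simp_rw [hres]
  rw [inner_sub_left, sum_inner, mul_sub, Finset.mul_sum]
  have : ∀ i, a * inner ℝ (c i • φ i) g = a * c i * inner ℝ (φ i) g := fun i => by
    rw [real_inner_smul_left]; ring
  simp_rw [this]
  ring

/-- Cauchy–Schwarz on `ℝ^ι ⊕ E` with the second summand weighted by `a`: the inner product of a
regularized design. -/
theorem add_mul_inner_sq_le {E ι : Type*} [Fintype ι] [NormedAddCommGroup E]
    [InnerProductSpace ℝ E] (x y : ι → ℝ) (e g : E) {a : ℝ} (ha : 0 ≤ a) :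
    (∑ i, x i * y i + a * inner ℝ e g) ^ 2 ≤
      (∑ i, x i ^ 2 + a * ‖e‖ ^ 2) * (∑ i, y i ^ 2 + a * ‖g‖ ^ 2) := by
  have h1 := Finset.sum_mul_sq_le_sq_mul_sq Finset.univ x y
  have h2 := abs_real_inner_le_norm e g
  have hx : 0 ≤ ∑ i, x i ^ 2 := Finset.sum_nonneg fun _ _ => sq_nonneg _
  have hy : 0 ≤ ∑ i, y i ^ 2 := Finset.sum_nonneg fun _ _ => sq_nonneg _
  set S := ∑ i, x i * y i
  have hS : |S| ≤ √(∑ i, x i ^ 2) * √(∑ i, y i ^ 2) := by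
    rw [← Real.sqrt_mul hx]; exact Real.abs_le_sqrt h1
  rw [← Real.sq_sqrt hx, ← Real.sq_sqrt hy]
  set u := √(∑ i, x i ^ 2)
  set v := √(∑ i, y i ^ 2)
  have h3 : |S + a * inner ℝ e g| ≤ u * v + a * (‖e‖ * ‖g‖) := by
    refine (abs_add_le _ _).trans (add_le_add hS ?_)
    rw [abs_mul, abs_of_nonneg ha]
    exact mul_le_mul_of_nonneg_left h2 ha
  have h4 := pow_le_pow_left₀ (abs_nonneg _) h3 2
  rw [sq_abs] at h4
  have := mul_nonneg ha (sq_nonneg (u * ‖g‖ - v * ‖e‖))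
  nlinarith

section Uncertainty

variable {X E : Type*} [NormedAddCommGroup E] [InnerProductSpace ℝ E] {ψ : X × X → E}
  {q : X × X → X × X → ℝ}

theorem uncertainty_nonneg (a : ℝ) {n : ℕ} (pts : Fin n → X × X) (w : X × X) :
    0 ≤ uncertainty q a pts w := Real.sqrt_nonneg _

/-- The vector is `e = a (∑ φᵢ ⊗ φᵢ + a)⁻¹ ψ w`. It replaces the matrix formula by a dual equation
to be tested against vectors; testing with `e` also shows that the radicand is nonnegative, so the
square root does not truncate. -/
theorem exists_uncertainty_dual (hq : ∀ p p', q p p' = inner ℝ (ψ p) (ψ p')) {a : ℝ}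
    (ha : 0 < a) {n : ℕ} (pts : Fin n → X × X) (w : X × X) :
    ∃ e : E, (∀ g, ∑ i, inner ℝ (ψ (pts i)) e * inner ℝ (ψ (pts i)) g + a * inner ℝ e g =
      a * inner ℝ (ψ w) g) ∧ uncertainty q a pts w ^ 2 = inner ℝ (ψ w) e ∧
      uncertainty q a pts w ^ 2 = q w w - (fun i => q w (pts i)) ⬝ᵥ
        (((gram q pts + a • (1 : Matrix (Fin n) (Fin n) ℝ))⁻¹).mulVec fun i => q w (pts i)) := by
  set c := ((gram q pts + a • (1 : Matrix (Fin n) (Fin n) ℝ))⁻¹).mulVec fun i => q w (pts i)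
    with hc
  have hmain := ridge_normal_eq (fun i => ψ (pts i)) (ψ w) ha (gram q pts)
    (fun i j => by simp [gram, hq]) c (by
      rw [hc]; congr 1; ext i; rw [hq, real_inner_comm])
  have harg : q w w - (fun i => q w (pts i)) ⬝ᵥ c = inner ℝ (ψ w) (ψ w - ∑ j, c j • ψ (pts j)) := by
    rw [inner_sub_right, inner_sum, hq]
    simp only [dotProduct, hq, inner_smul_right]
    congr 1
    exact Finset.sum_congr rfl fun _ _ => mul_comm _ _
  have hpos : 0 ≤ q w w - (fun i => q w (pts i)) ⬝ᵥ c := by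
    rw [harg]
    have h := hmain (ψ w - ∑ j, c j • ψ (pts j))
    rw [real_inner_self_eq_norm_sq] at h
    have h1 : 0 ≤ a * inner ℝ (ψ w) (ψ w - ∑ j, c j • ψ (pts j)) := by
      rw [← h]
      exact add_nonneg (Finset.sum_nonneg fun _ _ => mul_self_nonneg _)
        (mul_nonneg ha.le (sq_nonneg _))
    exact nonneg_of_mul_nonneg_right h1 ha
  refine ⟨_, hmain, ?_, ?_⟩
  · rw [← harg, uncertainty, Real.sq_sqrt hpos]
  · rw [uncertainty, Real.sq_sqrt hpos]

/-- Cauchy–Schwarz against the dual vector: `σ² / a` bounds the squared norm of evaluation at `w` in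
the norm of the regularized design. -/
theorem inner_sq_le_uncertainty (hq : ∀ p p', q p p' = inner ℝ (ψ p) (ψ p')) {a : ℝ}
    (ha : 0 < a) {n : ℕ} (pts : Fin n → X × X) (w : X × X) (g : E) :
    a * inner ℝ (ψ w) g ^ 2 ≤ uncertainty q a pts w ^ 2 *
      (∑ i, inner ℝ (ψ (pts i)) g ^ 2 + a * ‖g‖ ^ 2) := by
  obtain ⟨e, he, hs, -⟩ := exists_uncertainty_dual hq ha pts w
  have h := add_mul_inner_sq_le (fun i => inner ℝ (ψ (pts i)) e)
    (fun i => inner ℝ (ψ (pts i)) g) e g ha.le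
  have h2 := he e
  rw [real_inner_self_eq_norm_sq, ← hs] at h2
  simp only [← sq] at h2
  rw [he g, h2] at h
  rw [← mul_le_mul_iff_right₀ ha]
  linarith

/-- The uncertainty relative to the ridge decreases when the regularized design grows. -/
theorem uncertainty_comparison (hq : ∀ p p', q p p' = inner ℝ (ψ p) (ψ p')) {a a' : ℝ}
    (ha : 0 < a) (ha' : 0 < a') {n n' : ℕ} (pts : Fin n → X × X) (pts' : Fin n' → X × X)
    (h : ∀ g : E, ∑ i, inner ℝ (ψ (pts i)) g ^ 2 + a * ‖g‖ ^ 2 ≤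
      ∑ i, inner ℝ (ψ (pts' i)) g ^ 2 + a' * ‖g‖ ^ 2) (w : X × X) :
    uncertainty q a' pts' w ^ 2 / a' ≤ uncertainty q a pts w ^ 2 / a := by
  obtain ⟨e, he, hs, -⟩ := exists_uncertainty_dual hq ha' pts' w
  have h1 := inner_sq_le_uncertainty hq ha pts w e
  have h2 := he e
  rw [real_inner_self_eq_norm_sq, ← hs] at h2
  simp only [← sq] at h2
  have h3 := h1.trans (mul_le_mul_of_nonneg_left (h e) (sq_nonneg _))
  rw [h2, ← hs] at h3
  rw [div_le_div_iff₀ ha' ha]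
  rcases (sq_nonneg (uncertainty q a' pts' w)).eq_or_lt with h0 | h0
  · rw [← h0, zero_mul]; positivity
  · nlinarith

theorem uncertainty_anti_prefix (hq : ∀ p p', q p p' = inner ℝ (ψ p) (ψ p')) {a : ℝ}
    (ha : 0 < a) (z : ℕ → X × X) {n N : ℕ} (hn : n ≤ N) (w : X × X) :
    uncertainty q a (fun i : Fin N => z i) w ≤ uncertainty q a (fun i : Fin n => z i) w := by
  have h := uncertainty_comparison hq ha ha (fun i : Fin n => z i) (fun i : Fin N => z i)
    (fun g => by
      rw [Fin.sum_univ_eq_sum_range (fun i => inner ℝ (ψ (z i)) g ^ 2),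
        Fin.sum_univ_eq_sum_range (fun i => inner ℝ (ψ (z i)) g ^ 2)]
      gcongr) w
  rw [div_le_div_iff_of_pos_right ha] at h
  exact (pow_le_pow_iff_left₀ (uncertainty_nonneg _ _ _) (uncertainty_nonneg _ _ _)
    two_ne_zero).1 h

theorem uncertainty_sq_le_self (hq : ∀ p p', q p p' = inner ℝ (ψ p) (ψ p')) {a : ℝ}
    (ha : 0 < a) {n : ℕ} (pts : Fin n → X × X) (w : X × X) :
    uncertainty q a pts w ^ 2 ≤ q w w := by
  have h := uncertainty_comparison hq ha ha (fun i : Fin 0 => w) pts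
    (fun g => by
      simp only [Finset.univ_eq_empty, Finset.sum_empty, zero_add]
      exact le_add_of_nonneg_left (Finset.sum_nonneg fun _ _ => sq_nonneg _)) w
  rw [div_le_div_iff_of_pos_right ha] at h
  obtain ⟨e, -, -, hs⟩ := exists_uncertainty_dual hq ha (fun i : Fin 0 => w) w
  refine h.trans_eq ?_
  rw [hs]; simp

/-- Testing the dual equation with `e` gives `∑ ⟨φᵢ, e⟩² + a ‖e‖² = a σ²`, where each repetition of
`w` among the queries contributes `σ⁴`. -/
theorem card_mul_uncertainty_sq_le (hq : ∀ p p', q p p' = inner ℝ (ψ p) (ψ p')) {a : ℝ}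
    (ha : 0 < a) {n : ℕ} (pts : Fin n → X × X) (w : X × X) (S : Finset (Fin n))
    (hS : ∀ i ∈ S, pts i = w) : (S.card : ℝ) * uncertainty q a pts w ^ 2 ≤ a := by
  obtain ⟨e, he, hs, -⟩ := exists_uncertainty_dual hq ha pts w
  have h2 := he e
  rw [real_inner_self_eq_norm_sq, ← hs] at h2
  simp only [← sq] at h2
  have h3 : (S.card : ℝ) * (uncertainty q a pts w ^ 2) ^ 2 ≤
      ∑ i, inner ℝ (ψ (pts i)) e ^ 2 := by
    calc (S.card : ℝ) * (uncertainty q a pts w ^ 2) ^ 2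
        = ∑ i ∈ S, inner ℝ (ψ (pts i)) e ^ 2 := by
          rw [← nsmul_eq_mul, ← Finset.sum_const]
          exact Finset.sum_congr rfl fun i hi => by rw [hS i hi, hs]
      _ ≤ _ := Finset.sum_le_sum_of_subset_of_nonneg (Finset.subset_univ _)
          fun _ _ _ => sq_nonneg _
  rcases (sq_nonneg (uncertainty q a pts w)).eq_or_lt with h0 | h0
  · rw [← h0]; simpa using ha.le
  · have h4 : 0 ≤ a * ‖e‖ ^ 2 := by positivity
    by_contra hcon
    push Not at hcon
    have := mul_lt_mul_of_pos_right hcon h0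
    nlinarith

theorem uncertainty_congr_neg (hq : ∀ p p', q p p' = inner ℝ (ψ p) (ψ p')) (a : ℝ) {n : ℕ} (pts : Fin n → X × X) {w w' : X × X} (hw : ψ w' = -ψ w) :
    uncertainty q a pts w' = uncertainty q a pts w := by
  have e1 : q w' w' = q w w := by simp [hq, hw]
  have e2 : (fun i => q w' (pts i)) = -fun i => q w (pts i) := by
    ext i; simp [hq, hw]
  rw [uncertainty, uncertainty, e1, e2, Matrix.mulVec_neg, neg_dotProduct_neg]

/-- The representer `v` of evaluation at `w` for the weighted regularized design, with its norms
bounded through the unweighted uncertainty. -/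
theorem exists_weighted_representer (hq : ∀ p p', q p p' = inner ℝ (ψ p) (ψ p')) {lam κ : ℝ}
    (hlam : 0 < lam) (hκ : 0 < κ) {n : ℕ} (pts : Fin n → X × X) (w : X × X) (m : Fin n → ℝ)
    (hm : ∀ i, 0 ≤ m i) :
    ∃ v : E, (∀ g, ∑ i, m i * (inner ℝ (ψ (pts i)) v * inner ℝ (ψ (pts i)) g) +
        lam * inner ℝ v g = inner ℝ (ψ w) g) ∧ 0 ≤ inner ℝ (ψ w) v ∧
      lam * ‖v‖ ^ 2 ≤ inner ℝ (ψ w) v ∧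
      ((∀ i, 1 / κ ≤ m i) → ∑ i, inner ℝ (ψ (pts i)) v ^ 2 ≤ κ * inner ℝ (ψ w) v ∧
        lam * inner ℝ (ψ w) v ≤ uncertainty q (lam * κ) pts w ^ 2) := by
  -- Absorbing the square roots of the weights into the features reduces the weighted equation to
  -- the unweighted one.
  set φ : Fin n → E := fun i => √(m i) • ψ (pts i) with hφ
  obtain ⟨v, hv⟩ : ∃ v : E, ∀ g, ∑ i, m i * (inner ℝ (ψ (pts i)) v * inner ℝ (ψ (pts i)) g) +
      lam * inner ℝ v g = inner ℝ (ψ w) g := by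
    have h := ridge_normal_eq φ (lam⁻¹ • ψ w) hlam (Matrix.gram ℝ φ)
      (fun i j => Matrix.gram_apply _ _ _) _ rfl
    refine ⟨(lam⁻¹ • ψ w) - ∑ j, (((Matrix.gram ℝ φ +
        lam • (1 : Matrix (Fin n) (Fin n) ℝ))⁻¹).mulVec fun i => inner ℝ (φ i) (lam⁻¹ • ψ w)) j • φ j, fun g => ?_⟩
    · have hg := h g
      rw [real_inner_smul_left (ψ w), mul_inv_cancel_left₀ hlam.ne'] at hg
      rw [← hg]
      congr 1
      refine Finset.sum_congr rfl fun i _ => ?_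
      have e1 : ∀ x : E, inner ℝ (φ i) x = √(m i) * inner ℝ (ψ (pts i)) x := fun x => by
        rw [hφ, real_inner_smul_left]
      rw [e1 g, e1 (_ - _)]
      conv_lhs => rw [← Real.mul_self_sqrt (hm i)]
      ring
  have hself := hv v
  rw [real_inner_self_eq_norm_sq] at hself
  simp only [← sq] at hself
  have hsum : 0 ≤ ∑ i, m i * inner ℝ (ψ (pts i)) v ^ 2 :=
    Finset.sum_nonneg fun i _ => mul_nonneg (hm i) (sq_nonneg _)
  have hnorm : 0 ≤ lam * ‖v‖ ^ 2 := by positivity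
  refine ⟨v, hv, by linarith, by linarith, fun hmκ => ?_⟩
  have hκsum : ∑ i, inner ℝ (ψ (pts i)) v ^ 2 ≤ κ * ∑ i, m i * inner ℝ (ψ (pts i)) v ^ 2 := by
    rw [Finset.mul_sum]
    refine Finset.sum_le_sum fun i _ => ?_
    have h1 : 1 ≤ κ * m i := by
      have := mul_le_mul_of_nonneg_left (hmκ i) hκ.le
      rwa [mul_one_div_cancel hκ.ne'] at this
    rw [← mul_assoc]
    exact le_mul_of_one_le_left (sq_nonneg _) h1
  refine ⟨hκsum.trans (mul_le_mul_of_nonneg_left (by linarith) hκ.le), ?_⟩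
  -- Weights of at least `1 / κ` with ridge `lam` dominate `1 / κ` times the unweighted design with
  -- ridge `lam * κ`, which is why the uncertainty carries that ridge.
  have h1 := inner_sq_le_uncertainty hq (mul_pos hlam hκ) pts w v
  have h2 : ∑ i, inner ℝ (ψ (pts i)) v ^ 2 + lam * κ * ‖v‖ ^ 2 ≤ κ * inner ℝ (ψ w) v := by
    rw [← hself]; nlinarith
  have h3 := h1.trans (mul_le_mul_of_nonneg_left h2 (sq_nonneg _))
  set s := inner ℝ (ψ w) v
  have hs : 0 ≤ s := by linarith
  rcases hs.eq_or_lt with h0 | h0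
  · rw [← h0]; simpa using sq_nonneg _
  · have : (κ * s) * (lam * s) ≤ (κ * s) * uncertainty q (lam * κ) pts w ^ 2 := by linarith
    exact le_of_mul_le_mul_left this (mul_pos hκ h0)

end Uncertainty

/-! ### Information gain and maximum-uncertainty sampling -/

section InfoGain

variable {X E : Type*} [NormedAddCommGroup E] [InnerProductSpace ℝ E] {ψ : X × X → E}
  {q : X × X → X × X → ℝ}

theorem gram_add_smul_one_posDef (hq : ∀ p p', q p p' = inner ℝ (ψ p) (ψ p')) {a : ℝ}
    (ha : 0 < a) {n : ℕ} (pts : Fin n → X × X) :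
    (gram q pts + a • (1 : Matrix (Fin n) (Fin n) ℝ)).PosDef := by
  have hGram : gram q pts = Matrix.gram ℝ fun i => ψ (pts i) := by
    ext i j; simp [gram, Matrix.gram_apply, hq]
  rw [hGram]
  exact Matrix.PosDef.posSemidef_add (Matrix.posSemidef_gram ℝ _) (Matrix.PosDef.one.smul ha)

/-- The new factor is the Schur complement of the old block in the bordered Gram matrix. -/
theorem det_gram_succ (hq : ∀ p p', q p p' = inner ℝ (ψ p) (ψ p')) {a : ℝ} (ha : 0 < a)
    (z : ℕ → X × X) (n : ℕ) :
    (gram q (fun i : Fin (n + 1) => z i) + a • (1 : Matrix (Fin (n + 1)) (Fin (n + 1)) ℝ)).det =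
      (gram q (fun i : Fin n => z i) + a • (1 : Matrix (Fin n) (Fin n) ℝ)).det *
        (a + uncertainty q a (fun i : Fin n => z i) (z n) ^ 2) := by
  set A := gram q (fun i : Fin n => z i) + a • (1 : Matrix (Fin n) (Fin n) ℝ) with hA
  set c : Fin n → ℝ := fun i => q (z n) (z i) with hc
  have hunit : IsUnit A := (gram_add_smul_one_posDef hq ha _).isUnit
  let _ : Invertible A := hunit.invertible
  have hsymm : ∀ p p', q p p' = q p' p := fun p p' => by rw [hq, hq, real_inner_comm]
  have hblock : (gram q (fun i : Fin (n + 1) => z i) +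
      a • (1 : Matrix (Fin (n + 1)) (Fin (n + 1)) ℝ)).submatrix finSumFinEquiv finSumFinEquiv =
      Matrix.fromBlocks A (Matrix.of fun i (_ : Fin 1) => c i) (Matrix.of fun (_ : Fin 1) i => c i)
        (Matrix.of fun (_ _ : Fin 1) => q (z n) (z n) + a) := by
    ext i j
    rcases i with i | i <;> rcases j with j | j
    · simp [hA, gram, Matrix.one_apply, Fin.ext_iff]
    · have : (i : ℕ) ≠ n := i.2.ne
      simp [gram, Fin.ext_iff, hc, hsymm (z i), this]
    · have : n ≠ (j : ℕ) := j.2.ne'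
      simp [gram, Fin.ext_iff, hc, this]
    · simp [gram, Matrix.one_apply, Fin.ext_iff]
  obtain ⟨-, -, -, hs⟩ := exists_uncertainty_dual hq ha (fun i : Fin n => z i) (z n)
  rw [← Matrix.det_submatrix_equiv_self finSumFinEquiv, hblock, Matrix.det_fromBlocks₁₁, hs]
  congr 1
  rw [Matrix.det_fin_one, Matrix.invOf_eq_nonsing_inv]
  simp only [Matrix.sub_apply, Matrix.of_apply]
  rw [Matrix.mul_assoc]
  have : ((Matrix.of fun (_ : Fin 1) i => c i) * (A⁻¹ * Matrix.of fun i (_ : Fin 1) => c i)) 0 0 =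
      c ⬝ᵥ A⁻¹.mulVec c := by
    simp [Matrix.mul_apply, dotProduct, Matrix.mulVec]
  rw [this]
  ring

/-- The chain rule for information gain, by iterating the Schur complement. -/
theorem log_det_eq_sum (hq : ∀ p p', q p p' = inner ℝ (ψ p) (ψ p')) {a : ℝ} (ha : 0 < a)
    (z : ℕ → X × X) (n : ℕ) :
    Real.log ((1 : Matrix (Fin n) (Fin n) ℝ) + a⁻¹ • gram q (fun i : Fin n => z i)).det =
      ∑ i ∈ Finset.range n,
        Real.log (1 + uncertainty q a (fun j : Fin i => z j) (z i) ^ 2 / a) := by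
  have hscale : ∀ n : ℕ, ((1 : Matrix (Fin n) (Fin n) ℝ) + a⁻¹ • gram q (fun i : Fin n => z i)).det
      = a⁻¹ ^ n * (gram q (fun i : Fin n => z i) + a • (1 : Matrix (Fin n) (Fin n) ℝ)).det := by
    intro n
    have : (1 : Matrix (Fin n) (Fin n) ℝ) + a⁻¹ • gram q (fun i : Fin n => z i) =
        a⁻¹ • (gram q (fun i : Fin n => z i) + a • (1 : Matrix (Fin n) (Fin n) ℝ)) := by
      rw [smul_add, smul_smul, inv_mul_cancel₀ ha.ne', one_smul, add_comm]
    rw [this, Matrix.det_smul, Fintype.card_fin]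
  induction n with
  | zero => simp
  | succ n ih =>
    have hpos : 0 < ((1 : Matrix (Fin n) (Fin n) ℝ) + a⁻¹ • gram q (fun i : Fin n => z i)).det := by
      rw [hscale]
      exact mul_pos (pow_pos (inv_pos.2 ha) _) (gram_add_smul_one_posDef hq ha _).det_pos
    have hfac : 0 < 1 + uncertainty q a (fun j : Fin n => z j) (z n) ^ 2 / a := by positivity
    rw [Finset.sum_range_succ, ← ih, ← Real.log_mul hpos.ne' hfac.ne', hscale, hscale,
      det_gram_succ hq ha]
    congr 1
    rw [pow_succ]
    field_simp

/-- A larger ridge lowers the ratio of `σ²` to the ridge, and the steps from `N` to `T` add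
nonnegative terms. It is used with ridges `4λ` and `6λ`. -/
theorem sum_log_le_maxInfoGain [Finite X] (hq : ∀ p p', q p p' = inner ℝ (ψ p) (ψ p')) {a a' : ℝ}
    (ha : 0 < a) (haa : a ≤ a') (z : ℕ → X × X) {N T : ℕ} (hN : N ≤ T) :
    ∑ i ∈ Finset.range N,
        Real.log (1 + uncertainty q a' (fun j : Fin i => z j) (z i) ^ 2 / a') ≤
      2 * maxInfoGain q a T := by
  have ha' : 0 < a' := ha.trans_le haa
  have h1 : 1 / 2 * Real.log ((1 : Matrix (Fin T) (Fin T) ℝ) +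
      a⁻¹ • gram q (fun i : Fin T => z i)).det ≤ maxInfoGain q a T :=
    le_ciSup (f := fun pts : Fin T → X × X =>
      1 / 2 * Real.log (((1 : Matrix (Fin T) (Fin T) ℝ) + a⁻¹ • gram q pts).det))
      (Set.finite_range _).bddAbove (fun i : Fin T => z i)
  rw [log_det_eq_sum hq ha] at h1
  have h2 : ∑ i ∈ Finset.range N,
        Real.log (1 + uncertainty q a' (fun j : Fin i => z j) (z i) ^ 2 / a') ≤
      ∑ i ∈ Finset.range N,
        Real.log (1 + uncertainty q a (fun j : Fin i => z j) (z i) ^ 2 / a) := by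
    refine Finset.sum_le_sum fun i _ => Real.log_le_log (by positivity) ?_
    have := uncertainty_comparison hq ha ha' (fun j : Fin i => z j) (fun j : Fin i => z j)
      (fun g => by gcongr) (z i)
    linarith
  have h3 := Finset.sum_le_sum_of_subset_of_nonneg (Finset.range_subset_range.2 hN)
    (fun i _ _ => Real.log_nonneg (show
      1 ≤ 1 + uncertainty q a (fun j : Fin i => z j) (z i) ^ 2 / a by
        have : 0 ≤ uncertainty q a (fun j : Fin i => z j) (z i) ^ 2 / a := by positivity
        linarith))
  linarith

/-- By concavity, the logarithm lies above its chord over `[1, 1 + M / a]`. -/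
theorem le_mul_log_one_add {s a M : ℝ} (ha : 0 < a) (hM : 0 < M) (hs0 : 0 ≤ s) (hs : s ≤ M) :
    s ≤ M / Real.log (1 + M / a) * Real.log (1 + s / a) := by
  have hlog : 0 < Real.log (1 + M / a) := Real.log_pos (by
    have : 0 < M / a := by positivity
    linarith)
  have hmem : 1 + M / a ∈ Set.Ioi (0 : ℝ) := Set.mem_Ioi.2 (by positivity)
  have hw : 0 ≤ 1 - s / M := by rw [sub_nonneg, div_le_one hM]; exact hs
  have hw' : 0 ≤ s / M := by positivity
  have hconc := strictConcaveOn_log_Ioi.concaveOn.2 (Set.mem_Ioi.2 one_pos) hmem hw hw'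
    (sub_add_cancel _ _)
  simp only [smul_eq_mul, Real.log_one, mul_zero, zero_add] at hconc
  have e : (1 - s / M) * 1 + s / M * (1 + M / a) = 1 + s / a := by field_simp; ring
  rw [e] at hconc
  have h2 := mul_le_mul_of_nonneg_left hconc (div_nonneg hM.le hlog.le)
  refine le_trans (le_of_eq ?_) h2
  generalize Real.log (1 + M / a) = ℓ at hlog
  field_simp

/-- Maximum-uncertainty sampling: the final uncertainty is controlled by the information gain. -/
theorem uncertainty_sq_le_infoGain [Finite X] (hq : ∀ p p', q p p' = inner ℝ (ψ p) (ψ p'))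
    (hq4 : ∀ p, q p p ≤ 4) {a a' : ℝ} (ha : 0 < a) (haa : a ≤ a') (z : ℕ → X × X) {N T : ℕ}
    (hN0 : 0 < N) (hN : N ≤ T) (w : X × X)
    (hmax : ∀ n < N, uncertainty q a' (fun j : Fin n => z j) w ≤
      uncertainty q a' (fun j : Fin n => z j) (z n)) :
    uncertainty q a' (fun j : Fin N => z j) w ^ 2 ≤
      8 / Real.log (1 + 4 / a') * (maxInfoGain q a T / N) := by
  have ha' : 0 < a' := ha.trans_le haa
  have hN' : (0 : ℝ) < N := by exact_mod_cast hN0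
  have hstep : ∀ n ∈ Finset.range N, uncertainty q a' (fun j : Fin N => z j) w ^ 2 ≤
      4 / Real.log (1 + 4 / a') *
        Real.log (1 + uncertainty q a' (fun j : Fin n => z j) (z n) ^ 2 / a') := by
    intro n hn
    rw [Finset.mem_range] at hn
    refine le_trans ?_ (le_mul_log_one_add ha' (by norm_num) (sq_nonneg _)
      ((uncertainty_sq_le_self hq ha' _ _).trans (hq4 _)))
    exact pow_le_pow_left₀ (uncertainty_nonneg _ _ _)
      ((uncertainty_anti_prefix hq ha' z hn.le w).trans (hmax n hn)) 2
  have hsum := Finset.sum_le_sum hstep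
  rw [Finset.sum_const, Finset.card_range, nsmul_eq_mul, ← Finset.mul_sum] at hsum
  have hlog : 0 < Real.log (1 + 4 / a') := Real.log_pos (by
    have : 0 < 4 / a' := by positivity
    linarith)
  have h := hsum.trans (mul_le_mul_of_nonneg_left (sum_log_le_maxInfoGain hq ha haa z hN)
    (div_nonneg (by norm_num) hlog.le))
  rw [← mul_div_assoc, le_div_iff₀ hN', mul_comm]
  refine h.trans (le_of_eq (by ring))

/-- Maximum-uncertainty sampling over a finite set: a pigeonhole bound on the uncertainty. -/
theorem mul_uncertainty_sq_le_of_card [Fintype X] (hq : ∀ p p', q p p' = inner ℝ (ψ p) (ψ p'))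
    {a : ℝ} (ha : 0 < a) (z : ℕ → X × X) {N m : ℕ}
    (hN : Fintype.card (X × X) * m < N) (w : X × X)
    (hmax : ∀ n < N, uncertainty q a (fun j : Fin n => z j) w ≤
      uncertainty q a (fun j : Fin n => z j) (z n)) :
    (m : ℝ) * uncertainty q a (fun j : Fin N => z j) w ^ 2 ≤ a := by
  classical
  obtain ⟨p, -, hp⟩ := Finset.exists_lt_card_fiber_of_mul_lt_card_of_maps_to
    (s := Finset.range N) (t := Finset.univ) (f := z) (n := m)
    (fun _ _ => Finset.mem_univ _) (by simpa using hN)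
  set S := (Finset.range N).filter fun i => z i = p with hS
  have hne : S.Nonempty := Finset.card_pos.1 (by omega)
  -- At the last time `k` that the popular pair `p` is queried, it has been queried at least `m`
  -- times before and still has maximal uncertainty.
  set k := S.max' hne with hk
  have hkS : k ∈ S := S.max'_mem hne
  have hkN : k < N := Finset.mem_range.1 (Finset.mem_filter.1 hkS).1
  have hkp : z k = p := (Finset.mem_filter.1 hkS).2
  have hcard : m ≤ (Finset.univ.filter fun j : Fin k => z j = p).card := by
    have h1 : (S.erase k).card ≤ (Finset.univ.filter fun j : Fin k => z j = p).card := by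
      refine Finset.card_le_card_of_surjOn (fun j : Fin k => (j : ℕ)) ?_
      intro i hi
      have hi' := Finset.mem_erase.1 (Finset.mem_coe.1 hi)
      have hik : i < k := lt_of_le_of_ne (S.le_max' i hi'.2) hi'.1
      exact ⟨⟨i, hik⟩, by simp [(Finset.mem_filter.1 hi'.2).2], rfl⟩
    rw [Finset.card_erase_of_mem hkS] at h1
    omega
  have h2 := card_mul_uncertainty_sq_le hq ha (fun j : Fin k => z j) p
    (Finset.univ.filter fun j : Fin k => z j = p) (fun i hi => (Finset.mem_filter.1 hi).2)
  have h3 : uncertainty q a (fun j : Fin N => z j) w ^ 2 ≤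
      uncertainty q a (fun j : Fin k => z j) p ^ 2 := by
    refine pow_le_pow_left₀ (uncertainty_nonneg _ _ _) ?_ 2
    rw [← hkp]
    exact (uncertainty_anti_prefix hq ha z hkN.le w).trans (hmax k hkN)
  calc (m : ℝ) * uncertainty q a (fun j : Fin N => z j) w ^ 2
      ≤ ((Finset.univ.filter fun j : Fin k => z j = p).card : ℝ) *
        uncertainty q a (fun j : Fin k => z j) p ^ 2 := by
        gcongr
    _ ≤ a := h2

end InfoGain

/-! ### Concentration of the feedback within one round -/

section Concentration

variable {X Ω : Type*} {mΩ : MeasurableSpace Ω} {P : Measure Ω} {ℱ : Filtration ℕ mΩ}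
  {u : X → ℝ} {T : ℕ} {z : ℕ → Ω → X × X} {y : ℕ → Ω → Bool}

theorem prefProb_nonneg (u : X → ℝ) (x x' : X) : 0 ≤ prefProb u x x' := Real.sigmoid_nonneg _

theorem prefProb_le_one (u : X → ℝ) (x x' : X) : prefProb u x x' ≤ 1 := Real.sigmoid_le_one _

/-- The feedback error of step `s + 1`, were the query of that step `p`. -/
noncomputable def feedbackError (u : X → ℝ) (y : Bool) (p : X × X) : ℝ :=
  (if y = true then 1 else 0) - prefProb u p.1 p.2

/-- The conditional law integrated over `A`. In this form the Chernoff bound follows by splitting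
events, with no further conditional expectations. -/
theorem IsBTLFeedback.measureReal_inter_feedback [IsProbabilityMeasure P]
    (hB : IsBTLFeedback P ℱ u T z y) {s : ℕ} (hs : s < T) {p : X × X} {A : Set Ω}
    (hA : MeasurableSet[ℱ s] A) (hAz : ∀ ω ∈ A, z s ω = p) :
    P.real (A ∩ {ω | y s ω = true}) = prefProb u p.1 p.2 * P.real A := by
  have hA' : MeasurableSet A := ℱ.le s _ hA
  have hy : MeasurableSet {ω | y s ω = true} := ℱ.le _ _ (hB.feedback_meas s hs)
  have hind : (fun ω => if y s ω = true then (1 : ℝ) else 0) =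
      Set.indicator {ω | y s ω = true} fun _ => (1 : ℝ) := by
    ext ω; simp [Set.indicator_apply]
  have hint : Integrable (fun ω => if y s ω = true then (1 : ℝ) else 0) P := by
    rw [hind]; exact (integrable_const _).indicator hy
  have h1 := setIntegral_condExp (ℱ.le s) hint hA
  have h2 : ∫ ω in A, (P[fun ω => if y s ω = true then (1 : ℝ) else 0 | ℱ s]) ω ∂P =
      ∫ _ in A, prefProb u p.1 p.2 ∂P := by
    refine setIntegral_congr_ae hA' ?_
    filter_upwards [hB.cond_law s hs] with ω hω hωA
    rw [hω, hAz ω hωA]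
  rw [h2, hind, setIntegral_indicator hy, setIntegral_const, setIntegral_const] at h1
  simp only [smul_eq_mul, mul_one] at h1
  rw [← h1, mul_comm]

theorem IsBTLFeedback.measureReal_inter_feedback_false [IsProbabilityMeasure P]
    (hB : IsBTLFeedback P ℱ u T z y) {s : ℕ} (hs : s < T) {p : X × X} {A : Set Ω}
    (hA : MeasurableSet[ℱ s] A) (hAz : ∀ ω ∈ A, z s ω = p) :
    P.real (A ∩ {ω | y s ω = false}) = (1 - prefProb u p.1 p.2) * P.real A := by
  have hy : MeasurableSet {ω | y s ω = true} := ℱ.le _ _ (hB.feedback_meas s hs)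
  have h := measureReal_inter_add_sdiff (μ := P) (s := A) hy
  rw [hB.measureReal_inter_feedback hs hA hAz] at h
  have e : A ∩ {ω | y s ω = false} = A \ {ω | y s ω = true} := by
    ext ω; simp
  rw [e]; linarith

/-- Chernoff bound for weighted feedback errors on an event that fixes the queries. -/
theorem IsBTLFeedback.chernoff [IsProbabilityMeasure P] (hB : IsBTLFeedback P ℱ u T z y)
    (n : ℕ) : ∀ (t : ℕ), t + n ≤ T → ∀ (q : Fin n → X × X) (w : Fin n → ℝ) (A : Set Ω),
      MeasurableSet[ℱ t] A → (∀ ω ∈ A, ∀ i : Fin n, z (t + i) ω = q i) → ∀ c : ℝ,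
      P.real (A ∩ {ω | c ≤ ∑ i, w i * feedbackError u (y (t + i) ω) (q i)}) ≤
        Real.exp (-c + (∑ i, w i ^ 2) / 8) * P.real A := by
  induction n with
  | zero =>
    intro t _ q w A _ _ c
    simp only [Finset.univ_eq_empty, Finset.sum_empty, zero_div, add_zero]
    rcases le_or_gt c 0 with hc | hc
    · refine (measureReal_mono Set.inter_subset_left).trans ?_
      exact le_mul_of_one_le_left measureReal_nonneg (Real.one_le_exp (by linarith))
    · have : {ω : Ω | c ≤ 0} = ∅ := by ext; simp [hc]
      rw [this]; simp only [Set.inter_empty, measureReal_empty]; positivity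
  | succ n ih =>
    intro t ht q w A hA hAz c
    have htT : t < T := by omega
    set p := prefProb u (q 0).1 (q 0).2 with hp
    have hA0 : ∀ ω ∈ A, z t ω = q 0 := fun ω hω => by simpa using hAz ω hω 0
    have hAs : ∀ ω ∈ A, ∀ i : Fin n, z (t + 1 + i) ω = q i.succ := fun ω hω i => by
      rw [← hAz ω hω i.succ]; simp only [Fin.val_succ]; congr 1; omega
    have hA1 : MeasurableSet[ℱ (t + 1)] A := ℱ.mono (Nat.le_succ t) _ hA
    have hyt := hB.feedback_meas t htT
    have hyf : MeasurableSet[ℱ (t + 1)] {ω | y t ω = false} := by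
      have : {ω | y t ω = false} = {ω | y t ω = true}ᶜ := by ext ω; simp
      rw [this]; exact hyt.compl
    set S := ∑ i : Fin n, w i.succ ^ 2 with hS
    -- Split according to the first answer: it shifts the threshold by its own weighted error, and
    -- the two cases recombine into the Bernoulli moment generating function.
    have h1 := ih (t + 1) (by omega) (fun i => q i.succ) (fun i => w i.succ) _ (hA1.inter hyt)
      (fun ω hω => hAs ω hω.1) (c - w 0 * (1 - p))
    have h2 := ih (t + 1) (by omega) (fun i => q i.succ) (fun i => w i.succ) _ (hA1.inter hyf)
      (fun ω hω => hAs ω hω.1) (c + w 0 * p)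
    rw [hB.measureReal_inter_feedback htT hA hA0, ← hp, ← hS] at h1
    rw [hB.measureReal_inter_feedback_false htT hA hA0, ← hp, ← hS] at h2
    have hsub : A ∩ {ω | c ≤ ∑ i, w i * feedbackError u (y (t + i) ω) (q i)} ⊆
        ((A ∩ {ω | y t ω = true}) ∩ {ω | c - w 0 * (1 - p) ≤
          ∑ i : Fin n, w i.succ * feedbackError u (y (t + 1 + i) ω) (q i.succ)}) ∪
        ((A ∩ {ω | y t ω = false}) ∩ {ω | c + w 0 * p ≤
          ∑ i : Fin n, w i.succ * feedbackError u (y (t + 1 + i) ω) (q i.succ)}) := by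
      rintro ω ⟨hωA, hω⟩
      simp only [Set.mem_ofPred_eq, Fin.sum_univ_succ, Fin.val_zero, add_zero, Fin.val_succ] at hω
      have e : ∀ i : Fin n, t + ((i : ℕ) + 1) = t + 1 + i := fun i => by omega
      simp only [e] at hω
      cases hy : y t ω with
      | true =>
        refine Or.inl ⟨⟨hωA, hy⟩, ?_⟩
        simp only [feedbackError, hy, if_true, ← hp] at hω
        simp only [Set.mem_ofPred_eq, feedbackError]
        linarith
      | false =>
        refine Or.inr ⟨⟨hωA, hy⟩, ?_⟩
        simp only [feedbackError, hy, Bool.false_eq_true, if_false, ← hp] at hω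
        simp only [Set.mem_ofPred_eq, feedbackError]
        linarith
    refine (measureReal_mono hsub).trans ((measureReal_union_le _ _).trans
      ((add_le_add h1 h2).trans ?_))
    have hmgf := bernoulli_mgf_le (prefProb_nonneg u (q 0).1 (q 0).2)
      (prefProb_le_one u (q 0).1 (q 0).2) (w 0)
    rw [← hp] at hmgf
    have e1 : Real.exp (-(c - w 0 * (1 - p)) + S / 8) =
        Real.exp (-c + S / 8) * Real.exp (w 0 * (1 - p)) := by
      rw [← Real.exp_add]; ring_nf
    have e2 : Real.exp (-(c + w 0 * p) + S / 8) =
        Real.exp (-c + S / 8) * Real.exp (-(w 0 * p)) := by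
      rw [← Real.exp_add]; ring_nf
    have e3 : Real.exp (-c + (∑ i, w i ^ 2) / 8) =
        Real.exp (-c + S / 8) * Real.exp (w 0 ^ 2 / 8) := by
      rw [← Real.exp_add, Fin.sum_univ_succ, ← hS]; ring_nf
    rw [e1, e2, e3]
    have hk : 0 ≤ Real.exp (-c + S / 8) * P.real A :=
      mul_nonneg (Real.exp_pos _).le measureReal_nonneg
    nlinarith [mul_le_mul_of_nonneg_left hmgf hk]

/-- Hoeffding bound for weighted feedback errors on an event that fixes the queries. -/
theorem IsBTLFeedback.hoeffding_on [IsProbabilityMeasure P] (hB : IsBTLFeedback P ℱ u T z y)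
    {n t : ℕ} (htn : t + n ≤ T) (q : Fin n → X × X) (w : Fin n → ℝ) {A : Set Ω}
    (hA : MeasurableSet[ℱ t] A) (hAz : ∀ ω ∈ A, ∀ i : Fin n, z (t + i) ω = q i) {ℓ : ℝ}
    (hℓ : 0 < ℓ) :
    P.real (A ∩ {ω | √(ℓ / 2 * ∑ i, w i ^ 2) <
      ∑ i, w i * feedbackError u (y (t + i) ω) (q i)}) ≤ Real.exp (-ℓ) * P.real A := by
  set S := ∑ i, w i ^ 2 with hS
  have hS0 : 0 ≤ S := Finset.sum_nonneg fun _ _ => sq_nonneg _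
  rcases hS0.eq_or_lt with h0 | h0
  · have hw : ∀ i, w i = 0 := fun i => by
      have := (Finset.sum_eq_zero_iff_of_nonneg fun i _ => sq_nonneg (w i)).1 h0.symm i
        (Finset.mem_univ i)
      exact pow_eq_zero_iff two_ne_zero |>.1 this
    simp only [hw, zero_mul, Finset.sum_const_zero, (Real.sqrt_nonneg _).not_gt, Set.ofPred_false,
      Set.inter_empty, measureReal_empty]
    positivity
  · set c := √(ℓ / 2 * S) with hc
    have hcpos : 0 < c := Real.sqrt_pos.2 (by positivity)
    have hcsq : c ^ 2 = ℓ / 2 * S := Real.sq_sqrt (by positivity)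
    -- The minimizer of `-θ c + θ² S / 8`, where the exponent is `-2 c² / S = -ℓ`.
    set θ := 4 * c / S with hθ
    have hθ0 : 0 < θ := by positivity
    have h := hB.chernoff n t htn q (fun i => θ * w i) A hA hAz (θ * c)
    have e : -(θ * c) + (∑ i, (θ * w i) ^ 2) / 8 = -ℓ := by
      have : ∑ i, (θ * w i) ^ 2 = θ ^ 2 * S := by
        rw [hS, Finset.mul_sum]; exact Finset.sum_congr rfl fun _ _ => by ring
      rw [this, hθ]
      have : c * c = ℓ / 2 * S := by rw [← hcsq]; ring
      field_simp
      nlinarith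
    rw [e] at h
    refine le_trans (measureReal_mono ?_) h
    rintro ω ⟨hω, hω2⟩
    refine ⟨hω, ?_⟩
    simp only [Set.mem_ofPred_eq, mul_assoc, ← Finset.mul_sum] at hω2 ⊢
    exact mul_le_mul_of_nonneg_left hω2.le hθ0.le

/-- Hoeffding bound for feedback errors with weights that depend on predictable queries. -/
theorem IsBTLFeedback.hoeffding [Fintype X] [IsProbabilityMeasure P]
    (hB : IsBTLFeedback P ℱ u T z y) {n t : ℕ} (htn : t + n ≤ T)
    (hz : ∀ i < n, ∀ p, MeasurableSet[ℱ t] {ω | z (t + i) ω = p})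
    (W : (Fin n → X × X) → Fin n → ℝ) {ℓ : ℝ} (hℓ : 0 < ℓ) :
    P.real {ω | √(ℓ / 2 * ∑ i, W (fun j : Fin n => z (t + j) ω) i ^ 2) <
      ∑ i, W (fun j : Fin n => z (t + j) ω) i * feedbackError u (y (t + i) ω) (z (t + i) ω)} ≤
      Real.exp (-ℓ) := by
  classical
  -- The queries of the round are known at time `t`, so these finitely many cells lie in `ℱ t`, and
  -- the weights are constant on each. Summing over disjoint cells costs no union bound.
  set A : (Fin n → X × X) → Set Ω := fun q => {ω | ∀ i : Fin n, z (t + i) ω = q i} with hAdef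
  have hA : ∀ q, MeasurableSet[ℱ t] (A q) := fun q => by
    have : A q = ⋂ i : Fin n, {ω | z (t + i) ω = q i} := by ext ω; simp [hAdef]
    rw [this]
    exact MeasurableSet.iInter fun i => hz i i.2 _
  have hdisj : Pairwise (Function.onFun Disjoint A) := by
    intro q q' hqq
    rw [Function.onFun, Set.disjoint_left]
    intro ω h1 h2
    exact hqq (funext fun i => (h1 i).symm.trans (h2 i))
  have hsum : ∑ q, P.real (A q) ≤ 1 := by
    rw [← measureReal_iUnion_fintype hdisj fun q => ℱ.le t _ (hA q)]
    exact measureReal_le_one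
  calc _ ≤ P.real (⋃ q, A q ∩ {ω | √(ℓ / 2 * ∑ i, W q i ^ 2) <
          ∑ i, W q i * feedbackError u (y (t + i) ω) (q i)}) := by
        refine measureReal_mono ?_
        intro ω hω
        exact Set.mem_iUnion.2 ⟨fun j : Fin n => z (t + j) ω, fun _ => rfl, hω⟩
    _ ≤ ∑ q, P.real (A q ∩ {ω | √(ℓ / 2 * ∑ i, W q i ^ 2) <
          ∑ i, W q i * feedbackError u (y (t + i) ω) (q i)}) := measureReal_iUnion_fintype_le _
    _ ≤ ∑ q, Real.exp (-ℓ) * P.real (A q) := Finset.sum_le_sum fun q _ =>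
        hB.hoeffding_on htn q (W q) (hA q) (fun ω hω => hω) hℓ
    _ ≤ Real.exp (-ℓ) := by
        rw [← Finset.mul_sum]
        exact mul_le_of_le_one_right (Real.exp_pos _).le hsum

end Concentration

/-! ### Arithmetic of the round schedule -/

theorem roundSize_succ (T r : ℕ) :
    roundSize T (r + 1) = min ⌈√((roundSize T r : ℝ) * (T : ℝ))⌉₊ (T - roundEnd T r) := rfl

theorem roundEnd_succ (T r : ℕ) : roundEnd T (r + 1) = roundEnd T r + roundSize T (r + 1) := rfl

theorem roundEnd_zero (T : ℕ) : roundEnd T 0 = 0 := rfl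

theorem roundSize_zero (T : ℕ) : roundSize T 0 = 1 := rfl

theorem roundEnd_pred_add {T r : ℕ} (hr : 1 ≤ r) :
    roundEnd T (r - 1) + roundSize T r = roundEnd T r := by
  obtain ⟨r, rfl⟩ := Nat.exists_eq_add_of_le' hr
  rfl

theorem roundEnd_le (T r : ℕ) : roundEnd T r ≤ T := by
  induction r with
  | zero => exact Nat.zero_le _
  | succ r ih =>
    rw [roundEnd_succ, roundSize_succ]
    have := min_le_right ⌈√((roundSize T r : ℝ) * (T : ℝ))⌉₊ (T - roundEnd T r)
    omega

theorem roundEnd_mono (T : ℕ) : Monotone (roundEnd T) :=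
  monotone_nat_of_le_succ fun r => by rw [roundEnd_succ]; omega

theorem one_le_roundSize_of_lt {T : ℕ} (r : ℕ) (h : roundEnd T (r - 1) < T) :
    1 ≤ roundSize T r := by
  induction r with
  | zero => exact le_rfl
  | succ r ih =>
    have hN := ih (lt_of_le_of_lt (roundEnd_mono T (by omega)) h)
    simp only [Nat.add_sub_cancel] at h
    rw [roundSize_succ]
    refine le_min (Nat.one_le_ceil_iff.2 (Real.sqrt_pos.2 (mul_pos ?_ ?_))) (by omega)
    · exact_mod_cast hN
    · exact_mod_cast (by omega : 0 < T)

/-- Every round before the horizon takes at least one sample. Hence the horizon is reached, and the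
infimum defining `numRounds` is attained. -/
theorem min_le_roundEnd (T r : ℕ) : min r T ≤ roundEnd T r := by
  induction r with
  | zero => simp
  | succ r ih =>
    rcases (roundEnd_le T r).eq_or_lt with h | h
    · have := roundEnd_mono T (Nat.le_succ r)
      simp only [Nat.succ_eq_add_one] at this
      omega
    · have := one_le_roundSize_of_lt (r + 1) (by simpa using h)
      rw [roundEnd_succ]
      omega

theorem roundEnd_numRounds (T : ℕ) : roundEnd T (numRounds T) = T :=
  Nat.sInf_mem (s := {r | roundEnd T r = T})
    ⟨T, le_antisymm (roundEnd_le T T) (by simpa using min_le_roundEnd T T)⟩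

theorem numRounds_le (T : ℕ) : numRounds T ≤ T :=
  Nat.sInf_le (le_antisymm (roundEnd_le T T) (by simpa using min_le_roundEnd T T))

theorem roundEnd_lt {T r : ℕ} (hr : r < numRounds T) : roundEnd T r < T :=
  lt_of_le_of_ne (roundEnd_le T r) fun h => Nat.notMem_of_lt_sInf hr h

/-- If the horizon cut this round short, the round would end at `T`, against the minimality of
`numRounds`. -/
theorem roundSize_succ_of_lt {T r : ℕ} (hr : r + 1 < numRounds T) :
    roundSize T (r + 1) = ⌈√((roundSize T r : ℝ) * (T : ℝ))⌉₊ := by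
  have h1 := roundEnd_lt hr
  rw [roundEnd_succ] at h1
  rw [roundSize_succ] at h1 ⊢
  refine min_eq_left ?_
  by_contra hcon
  push Not at hcon
  rw [min_eq_right hcon.le] at h1
  omega

theorem one_le_roundSize {T r : ℕ} (hr1 : 1 ≤ r) (hr : r ≤ numRounds T) : 1 ≤ roundSize T r :=
  one_le_roundSize_of_lt r (roundEnd_lt (by omega))

theorem sqrt_le_roundSize {T r : ℕ} (hr1 : 1 ≤ r) (hr : r < numRounds T) :
    √(T : ℝ) ≤ roundSize T r := by
  obtain ⟨r, rfl⟩ := Nat.exists_eq_add_of_le' hr1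
  rw [roundSize_succ_of_lt hr]
  refine le_trans (Real.sqrt_le_sqrt ?_) (Nat.le_ceil _)
  have : 1 ≤ roundSize T r := one_le_roundSize_of_lt r
    (lt_of_le_of_lt (roundEnd_mono T (by omega)) (roundEnd_lt (r := r) (by omega)))
  exact le_mul_of_one_le_left (Nat.cast_nonneg _) (by exact_mod_cast this)

theorem roundSize_le (T r : ℕ) (hr : 1 ≤ r) : roundSize T r ≤ T := by
  have h1 := roundEnd_pred_add (T := T) hr
  have h2 := roundEnd_le T r
  omega

theorem roundSize_le_succ {T r : ℕ} (hr1 : 1 ≤ r) (hr : r + 1 < numRounds T) :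
    roundSize T r ≤ roundSize T (r + 1) := by
  rw [roundSize_succ_of_lt hr]
  have h1 : (roundSize T r : ℝ) ≤ T := by exact_mod_cast roundSize_le T r hr1
  have h2 : (roundSize T r : ℝ) ≤ √((roundSize T r : ℝ) * (T : ℝ)) := by
    refine Real.le_sqrt_of_sq_le ?_
    rw [sq]
    exact mul_le_mul_of_nonneg_left h1 (Nat.cast_nonneg _)
  exact_mod_cast h2.trans (Nat.le_ceil _)

/-- Round sizes are nondecreasing before the last round, so the latest of these rounds is at least
as large as the average one. -/
theorem roundEnd_le_mul {T r : ℕ} (hr : r < numRounds T) :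
    roundEnd T r ≤ r * roundSize T r := by
  induction r with
  | zero => simp [roundEnd_zero]
  | succ r ih =>
    rcases Nat.eq_zero_or_pos r with h | h
    · subst h; simp [roundEnd_succ, roundEnd_zero]
    · have h1 := ih (by omega)
      have h2 := Nat.mul_le_mul_left r (roundSize_le_succ h hr)
      rw [roundEnd_succ]
      linarith

/-- One of the last two rounds takes at least the average number of samples. -/
theorem le_mul_roundSize {T : ℕ} (hR : 1 ≤ numRounds T) :
    T ≤ numRounds T * roundSize T (numRounds T - 1) ∨
      T ≤ numRounds T * roundSize T (numRounds T) := by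
  have h1 := roundEnd_pred_add (T := T) hR
  rw [roundEnd_numRounds] at h1
  have h2 := roundEnd_le_mul (T := T) (r := numRounds T - 1) (by omega)
  obtain ⟨r, hr⟩ := Nat.exists_eq_add_of_le' hR
  rw [hr] at h1 h2 ⊢
  simp only [Nat.add_sub_cancel] at h1 h2 ⊢
  rcases le_total (roundSize T r) (roundSize T (r + 1)) with h | h
  · right; nlinarith
  · left; nlinarith

/-- All rounds but the last take at least `√T` samples. The bound keeps a last round of size `T / R`
at order `√T`. -/
theorem numRounds_le_sqrt (T : ℕ) : (numRounds T : ℝ) ≤ √(T : ℝ) + 1 := by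
  have key : ∀ r, r < numRounds T → (r : ℝ) * √(T : ℝ) ≤ roundEnd T r := by
    intro r
    induction r with
    | zero => intro _; simp
    | succ r ih =>
      intro hr
      have h1 := ih (by omega)
      have h2 := sqrt_le_roundSize (r := r + 1) (by omega) hr
      rw [roundEnd_succ]; push_cast; linarith
  rcases Nat.eq_zero_or_pos (numRounds T) with h | h
  · rw [h]; simp; positivity
  · obtain ⟨r, hr⟩ := Nat.exists_eq_add_of_le' h
    have h1 := key r (by omega)
    have h2 : (roundEnd T r : ℝ) ≤ T := by exact_mod_cast roundEnd_le T r
    rw [hr]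
    push_cast
    have hT : 0 < T := by
      have := roundEnd_lt (T := T) (r := r) (by omega)
      omega
    have h3 : 0 < √(T : ℝ) := Real.sqrt_pos.2 (by exact_mod_cast hT)
    have h4 : (T : ℝ) = √(T : ℝ) * √(T : ℝ) := (Real.mul_self_sqrt (Nat.cast_nonneg _)).symm
    have : (r : ℝ) ≤ √(T : ℝ) := by
      refine le_of_mul_le_mul_right ?_ h3
      linarith
    linarith

/-- Two rounds take about `√T + T^(3/4)` samples, fewer than `T`. With three rounds, both of the
last two have `κ_r = 6`. -/
theorem three_le_numRounds {T : ℕ} (hT : 100 ≤ T) : 3 ≤ numRounds T := by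
  by_contra hcon
  have h1 : T ≤ roundEnd T 2 := by
    conv_lhs => rw [← roundEnd_numRounds T]
    exact roundEnd_mono T (by omega)
  have e : roundEnd T 2 = roundSize T 1 + roundSize T 2 := by
    rw [roundEnd_succ, roundEnd_succ, roundEnd_zero, zero_add]
  have hs : ∀ r, (roundSize T (r + 1) : ℝ) ≤ √((roundSize T r : ℝ) * (T : ℝ)) + 1 := fun r => by
    have h : (roundSize T (r + 1) : ℝ) ≤ ⌈√((roundSize T r : ℝ) * (T : ℝ))⌉₊ := by
      rw [roundSize_succ]; exact_mod_cast min_le_left _ _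
    exact h.trans (Nat.ceil_lt_add_one (Real.sqrt_nonneg _)).le
  have h2 := hs 0
  have h3 := hs 1
  rw [roundSize_zero, Nat.cast_one, one_mul] at h2
  rw [e] at h1
  have h1' : (T : ℝ) ≤ roundSize T 1 + roundSize T 2 := by exact_mod_cast h1
  simp only [zero_add] at h2
  norm_num at h3
  set s := √(T : ℝ) with hs_def
  have hsT : (T : ℝ) = s ^ 2 := (Real.sq_sqrt (Nat.cast_nonneg _)).symm
  have hs10 : 10 ≤ s := Real.le_sqrt_of_sq_le (by norm_num; exact_mod_cast hT)
  have h4 : √(roundSize T 1 : ℝ) * s ≤ s * s / 2 := by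
    have : √(roundSize T 1 : ℝ) ≤ s / 2 := by
      rw [Real.sqrt_le_left (by positivity)]
      nlinarith
    nlinarith
  nlinarith

/-! ### The dueling RKHS and optimality of the logistic estimate -/

section Representation

variable {X : Type*} {H : Type*} [NormedAddCommGroup H] [InnerProductSpace ℝ H] [CompleteSpace H]

theorem inner_kerFun_one [RKHS ℝ H X ℝ] (x : X) (f : H) :
    inner ℝ (RKHS.kerFun H x (1 : ℝ)) f = f x := by
  rw [RKHS.kerFun_inner]; simp

theorem realKernel_eq_inner [RKHS ℝ H X ℝ] (x y : X) :
    realKernel H x y = inner ℝ (RKHS.kerFun H x (1 : ℝ)) (RKHS.kerFun H y (1 : ℝ)) := by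
  rw [inner_kerFun_one, RKHS.kerFun_apply, realKernel]

theorem duelingKernel_eq_inner [RKHS ℝ H X ℝ] (z w : X × X) :
    duelingKernel (realKernel H) z w =
      inner ℝ (RKHS.kerFun H z.1 (1 : ℝ) - RKHS.kerFun H z.2 (1 : ℝ))
        (RKHS.kerFun H w.1 (1 : ℝ) - RKHS.kerFun H w.2 (1 : ℝ)) := by
  simp only [duelingKernel, realKernel_eq_inner, inner_sub_left, inner_sub_right]
  ring

theorem duelingKernel_self_le [RKHS ℝ H X ℝ] (hk : ∀ x x' : X, realKernel H x x' ≤ 1)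
    (z : X × X) : duelingKernel (realKernel H) z z ≤ 4 := by
  rw [duelingKernel_eq_inner, real_inner_self_eq_norm_sq]
  have h1 : ∀ x : X, ‖RKHS.kerFun H x (1 : ℝ)‖ ≤ 1 := fun x => by
    have := hk x x
    rw [realKernel_eq_inner, real_inner_self_eq_norm_sq] at this
    exact (sq_le_one_iff₀ (norm_nonneg _)).1 this
  have h2 := (norm_sub_le (RKHS.kerFun H z.1 (1 : ℝ)) (RKHS.kerFun H z.2 (1 : ℝ))).trans
    (add_le_add (h1 _) (h1 _))
  nlinarith [norm_nonneg (RKHS.kerFun H z.1 (1 : ℝ) - RKHS.kerFun H z.2 (1 : ℝ))]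

theorem abs_sub_le_of_norm_le [RKHS ℝ H X ℝ] (hk : ∀ x x' : X, realKernel H x x' ≤ 1) {f : H}
    {B : ℝ} (hf : ‖f‖ ≤ B) (x x' : X) : |f x - f x'| ≤ 2 * B := by
  have h := duelingKernel_self_le hk (x, x')
  rw [duelingKernel_eq_inner, real_inner_self_eq_norm_sq] at h
  rw [← inner_kerFun_one x, ← inner_kerFun_one x', ← inner_sub_left]
  refine (abs_real_inner_le_norm _ _).trans ?_
  have h2 := abs_le_of_sq_le_sq' (h.trans_eq (by norm_num : (4 : ℝ) = 2 ^ 2)) (by norm_num)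
  exact mul_le_mul h2.2 hf (norm_nonneg _) (by norm_num)

/-- The utility difference lies in the RKHS of the dueling kernel, with no larger norm. -/
theorem exists_difference_function [Fintype X] [RKHS ℝ H X ℝ] {D : Type*} [NormedAddCommGroup D]
    [InnerProductSpace ℝ D] [CompleteSpace D] [RKHS ℝ D (X × X) ℝ]
    (hD : ∀ z w : X × X, realKernel D z w = duelingKernel (realKernel H) z w) (f : H) :
    ∃ g : D, ‖g‖ ≤ ‖f‖ ∧ ∀ p : X × X, g p = f p.1 - f p.2 := by
  set Φ : X × X → H := fun p => RKHS.kerFun H p.1 (1 : ℝ) - RKHS.kerFun H p.2 (1 : ℝ) with hΦ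
  set S : Submodule ℝ H := Submodule.span ℝ (Set.range Φ) with hS
  have : FiniteDimensional ℝ S := FiniteDimensional.span_of_finite ℝ (Set.finite_range Φ)
  -- The features in `H` and the kernel functions of `D` have the same Gram matrix, so the
  -- coefficients of the projection of `f` can be reused in `D`; projecting does not increase the
  -- norm and keeps the values of `f p.1 - f p.2`.
  obtain ⟨c, hc⟩ := (Submodule.mem_span_range_iff_exists_fun ℝ).1
    (show S.starProjection f ∈ Submodule.span ℝ (Set.range Φ) from
      Submodule.starProjection_apply_mem S f)
  have hK : ∀ p w : X × X, inner ℝ (RKHS.kerFun D p (1 : ℝ)) (RKHS.kerFun D w (1 : ℝ)) =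
      inner ℝ (Φ p) (Φ w) := fun p w => by
    rw [← realKernel_eq_inner, hD, duelingKernel_eq_inner]
  have hnorm : ‖∑ p, c p • RKHS.kerFun D p (1 : ℝ)‖ ^ 2 = ‖∑ p, c p • Φ p‖ ^ 2 := by
    simp only [← real_inner_self_eq_norm_sq, sum_inner, inner_sum, real_inner_smul_left,
      real_inner_smul_right, hK]
  refine ⟨∑ p, c p • RKHS.kerFun D p (1 : ℝ), ?_, fun w => ?_⟩
  · refine le_trans ((pow_le_pow_iff_left₀ (norm_nonneg _) (norm_nonneg _) two_ne_zero).1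
      hnorm.le) ?_
    rw [hc]
    exact Submodule.norm_starProjection_apply_le S f
  · rw [← inner_kerFun_one]
    have h1 : inner ℝ (RKHS.kerFun D w (1 : ℝ)) (∑ p, c p • RKHS.kerFun D p (1 : ℝ)) =
        inner ℝ (Φ w) (∑ p, c p • Φ p) := by
      simp only [inner_sum, real_inner_smul_right, hK]
    have h2 : inner ℝ (Φ w) (S.starProjection f) = inner ℝ (Φ w) f := by
      rw [← Submodule.inner_starProjection_left_eq_right,
        Submodule.starProjection_eq_self_iff.2 (Submodule.subset_span (Set.mem_range_self w))]
    rw [h1, hc, h2, hΦ, inner_sub_left, inner_kerFun_one, inner_kerFun_one]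

theorem hasDerivAt_neg_log_sigmoid (s : ℝ) :
    HasDerivAt (fun s => -Real.log (Real.sigmoid s)) (Real.sigmoid s - 1) s := by
  have h := ((differentiable_sigmoid s).hasDerivAt.log (Real.sigmoid_pos s).ne').neg
  rw [deriv_sigmoid_apply] at h
  have hne := (Real.sigmoid_pos s).ne'
  have e : -(Real.sigmoid s * (1 - Real.sigmoid s) / Real.sigmoid s) = Real.sigmoid s - 1 := by
    field_simp; ring
  rw [e] at h
  exact h

theorem hasDerivAt_neg_log_one_sub_sigmoid (s : ℝ) :
    HasDerivAt (fun s => -Real.log (1 - Real.sigmoid s)) (Real.sigmoid s) s := by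
  have hne : 1 - Real.sigmoid s ≠ 0 := (sub_pos.2 (Real.sigmoid_lt_one s)).ne'
  have h := (((differentiable_sigmoid s).hasDerivAt.const_sub 1).log hne).neg
  rw [deriv_sigmoid_apply] at h
  have e : -(-(Real.sigmoid s * (1 - Real.sigmoid s)) / (1 - Real.sigmoid s)) =
      Real.sigmoid s := by
    field_simp
  rw [e] at h
  exact h

/-- First-order optimality of the regularized maximum likelihood estimate. -/
theorem logisticLoss_optimality {D : Type*} [NormedAddCommGroup D] [InnerProductSpace ℝ D]
    [RKHS ℝ D (X × X) ℝ] {lam : ℝ} {n : ℕ} {pts : Fin n → X × X} {obs : Fin n → Bool} {h : D}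
    (hmin : IsMinOn (logisticLoss (D := D) lam pts obs) Set.univ h) (v : D) :
    ∑ i, (Real.sigmoid (h (pts i)) - if obs i = true then 1 else 0) * v (pts i) +
      lam * inner ℝ h v = 0 := by
  have hline : ∀ i, HasDerivAt (fun t : ℝ => (h + t • v) (pts i)) (v (pts i)) 0 := by
    intro i
    have : (fun t : ℝ => (h + t • v) (pts i)) = fun t => h (pts i) + t * v (pts i) := by
      ext t; simp
    rw [this]
    simpa using ((hasDerivAt_id (0 : ℝ)).mul_const (v (pts i))).const_add (h (pts i))
  have hterm : ∀ i, HasDerivAt (fun t : ℝ =>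
      if obs i = true then -Real.log (Real.sigmoid ((h + t • v) (pts i)))
      else -Real.log (1 - Real.sigmoid ((h + t • v) (pts i))))
      ((Real.sigmoid (h (pts i)) - if obs i = true then 1 else 0) * v (pts i)) 0 := by
    intro i
    have e0 : (h + (0 : ℝ) • v) (pts i) = h (pts i) := by simp
    split_ifs
    · have h1 := hasDerivAt_neg_log_sigmoid ((h + (0 : ℝ) • v) (pts i))
      have h2 := HasDerivAt.comp (0 : ℝ) h1 (hline i)
      rw [e0] at h2
      exact h2
    · have h1 := hasDerivAt_neg_log_one_sub_sigmoid ((h + (0 : ℝ) • v) (pts i))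
      have h2 := HasDerivAt.comp (0 : ℝ) h1 (hline i)
      rw [e0] at h2
      rw [sub_zero]
      exact h2
  have hnorm : HasDerivAt (fun t : ℝ => lam / 2 * ‖h + t • v‖ ^ 2) (lam * inner ℝ h v) 0 := by
    have h1 : HasDerivAt (fun t : ℝ => h + t • v) v 0 := by
      simpa using ((hasDerivAt_id (0 : ℝ)).smul_const v).const_add h
    have h2 := (h1.norm_sq).const_mul (lam / 2)
    have e : lam / 2 * (2 * inner ℝ (h + (0 : ℝ) • v) v) = lam * inner ℝ h v := by
      rw [zero_smul, add_zero]; ring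
    rw [e] at h2
    exact h2
  have hsum := (HasDerivAt.fun_sum fun i (_ : i ∈ Finset.univ) => hterm i).add hnorm
  have hloc : IsLocalMin (fun t : ℝ => logisticLoss (D := D) lam pts obs (h + t • v)) 0 := by
    refine Filter.Eventually.of_forall fun t => ?_
    have := isMinOn_iff.1 hmin (h + t • v) (Set.mem_univ _)
    simpa using this
  exact hloc.hasDerivAt_eq_zero hsum

end Representation

/-! ### Error of the regularized maximum likelihood estimate in one round -/

/-- Grouping equal queries turns per-query noise bounds into a bound for all test functions. -/
theorem abs_sum_mul_le_of_grouped {Y : Type*} [Fintype Y] [DecidableEq Y] {n : ℕ} (q : Fin n → Y)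
    (ε : Fin n → ℝ) {c : ℝ} (hc : 0 ≤ c)
    (hε : ∀ p, |∑ i, (if q i = p then 1 else 0) * ε i| ≤
      √(c * ∑ i, (if q i = p then (1 : ℝ) else 0) ^ 2)) (F : Y → ℝ) :
    |∑ i, ε i * F (q i)| ≤ √(Fintype.card Y * c) * √(∑ i, F (q i) ^ 2) := by
  set m : Y → ℝ := fun p => ∑ i, (if q i = p then (1 : ℝ) else 0) ^ 2 with hm
  have hm0 : ∀ p, 0 ≤ m p := fun p => Finset.sum_nonneg fun _ _ => sq_nonneg _
  have e1 : ∑ i, ε i * F (q i) = ∑ p, (∑ i, (if q i = p then 1 else 0) * ε i) * F p := by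
    simp_rw [Finset.sum_mul]
    rw [Finset.sum_comm]
    refine Finset.sum_congr rfl fun i _ => ?_
    simp
  have e2 : ∑ i, F (q i) ^ 2 = ∑ p, m p * F p ^ 2 := by
    simp_rw [hm, Finset.sum_mul]
    rw [Finset.sum_comm]
    refine Finset.sum_congr rfl fun i _ => ?_
    simp
  rw [e1, e2]
  have h1 : |∑ p, (∑ i, (if q i = p then 1 else 0) * ε i) * F p| ≤
      ∑ p, √c * (√(m p) * |F p|) := by
    refine (Finset.abs_sum_le_sum_abs _ _).trans (Finset.sum_le_sum fun p _ => ?_)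
    rw [abs_mul, ← mul_assoc, ← Real.sqrt_mul hc]
    exact mul_le_mul_of_nonneg_right (hε p) (abs_nonneg _)
  have h2 : (∑ p, √(m p) * |F p|) ≤ √(Fintype.card Y) * √(∑ p, m p * F p ^ 2) := by
    rw [← Real.sqrt_mul (Nat.cast_nonneg _)]
    refine Real.le_sqrt_of_sq_le ?_
    have h := sq_sum_le_card_mul_sum_sq (s := (Finset.univ : Finset Y))
      (f := fun p => √(m p) * |F p|)
    rw [Finset.card_univ] at h
    refine h.trans_eq ?_
    congr 1
    refine Finset.sum_congr rfl fun p _ => ?_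
    rw [mul_pow, Real.sq_sqrt (hm0 p), sq_abs]
  refine h1.trans ?_
  rw [← Finset.mul_sum, mul_comm _ c, Real.sqrt_mul hc, mul_assoc]
  exact mul_le_mul_of_nonneg_left h2 (Real.sqrt_nonneg _)

section Round

variable {X E : Type*} [NormedAddCommGroup E] [InnerProductSpace ℝ E] {ψ : X × X → E}
  {q : X × X → X × X → ℝ}

/-- A first, rough estimate of the error of the maximum likelihood estimate at the queries. -/
theorem mle_error_rough (hq : ∀ p p', q p p' = inner ℝ (ψ p) (ψ p')) {lam κ B b c Q K τ : ℝ}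
    (hlam : 0 < lam) (hκ : 1 ≤ κ) {n : ℕ} {pts : Fin n → X × X} {g h : E} {ε : Fin n → ℝ}
    (hopt : ∀ v, ∑ i, (Real.sigmoid (inner ℝ (ψ (pts i)) h) -
        Real.sigmoid (inner ℝ (ψ (pts i)) g)) * inner ℝ (ψ (pts i)) v + lam * inner ℝ h v =
      ∑ i, ε i * inner ℝ (ψ (pts i)) v)
    (hgB : ‖g‖ ≤ B) (hgb : ∀ i, |inner ℝ (ψ (pts i)) g| ≤ b) (hc0 : 0 < c)
    (hc : c ≤ deriv Real.sigmoid (b + 1)) (hcκ : c * κ ≤ 1)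
    (hnoise : ∀ v, |∑ i, ε i * inner ℝ (ψ (pts i)) v| ≤
      Q * √(∑ i, inner ℝ (ψ (pts i)) v ^ 2))
    (hQ : 0 ≤ Q) (hK : Q + √lam * B ≤ K * c) (hτ : 0 ≤ τ) (hKτ : K * τ < 1)
    (hunc : ∀ i, uncertainty q (lam * κ) pts (pts i) ^ 2 ≤ lam * κ * τ ^ 2) :
    ∑ i, inner ℝ (ψ (pts i)) (h - g) ^ 2 ≤ K ^ 2 ∧
      ∀ i, |inner ℝ (ψ (pts i)) (h - g)| ≤ K * τ := by
  have hκ0 : 0 < κ := by linarith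
  have hB : 0 ≤ B := (norm_nonneg g).trans hgB
  have hK0 : 0 ≤ K := by
    have : 0 ≤ K * c := le_trans (by positivity) hK
    exact nonneg_of_mul_nonneg_left this hc0
  set d := h - g with hd
  set S := ∑ i, inner ℝ (ψ (pts i)) d ^ 2 with hS
  have hS0 : 0 ≤ S := Finset.sum_nonneg fun _ _ => sq_nonneg _
  set V := √(S + lam * κ * ‖d‖ ^ 2) with hV
  have hV0 : 0 ≤ V := Real.sqrt_nonneg _
  have hVsq : V ^ 2 = S + lam * κ * ‖d‖ ^ 2 := Real.sq_sqrt (by positivity)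
  have hdi : ∀ i, |inner ℝ (ψ (pts i)) d| ≤ V * τ := by
    intro i
    refine abs_le_of_sq_le_sq ?_ (by positivity)
    have h1 := inner_sq_le_uncertainty hq (mul_pos hlam hκ0) pts (pts i) d
    rw [← hVsq] at h1
    have h2 := h1.trans (mul_le_mul_of_nonneg_right (hunc i) (sq_nonneg V))
    have : lam * κ * inner ℝ (ψ (pts i)) d ^ 2 ≤ lam * κ * (V * τ) ^ 2 := by linarith
    exact le_of_mul_le_mul_left this (mul_pos hlam hκ0)
  -- The size of `h - g` at the queries is not known yet, so it is carried as `ρ` in the curvature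
  -- bound and removed at the end by self-consistency.
  set ρ := max 1 (V * τ) with hρ
  have hρ1 : 1 ≤ ρ := le_max_left _ _
  have hcurv : c / ρ * S ≤ ∑ i, (Real.sigmoid (inner ℝ (ψ (pts i)) h) -
      Real.sigmoid (inner ℝ (ψ (pts i)) g)) * inner ℝ (ψ (pts i)) d := by
    rw [hS, Finset.mul_sum]
    refine Finset.sum_le_sum fun i _ => ?_
    have e : inner ℝ (ψ (pts i)) d = inner ℝ (ψ (pts i)) h - inner ℝ (ψ (pts i)) g := by
      rw [hd, inner_sub_right]
    have hi := (hdi i).trans (le_max_right 1 (V * τ))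
    rw [e] at hi ⊢
    exact sigmoid_sub_mul_ge (hgb i) hc0.le hc hρ1 hi
  have hSV : √S ≤ V := Real.sqrt_le_sqrt (by
    have : 0 ≤ lam * κ * ‖d‖ ^ 2 := by positivity
    linarith)
  have hdV : √lam * ‖d‖ ≤ V := by
    refine Real.le_sqrt_of_sq_le ?_
    rw [mul_pow, Real.sq_sqrt hlam.le]
    have : lam * ‖d‖ ^ 2 * 1 ≤ lam * ‖d‖ ^ 2 * κ :=
      mul_le_mul_of_nonneg_left hκ (by positivity)
    linarith
  have hmain : c / ρ * V ^ 2 ≤ K * c * V := by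
    have h1 := hopt d
    have h2 := (le_abs_self _).trans (hnoise d)
    have h3 : inner ℝ h d = ‖d‖ ^ 2 + inner ℝ g d := by
      rw [← real_inner_self_eq_norm_sq, ← inner_add_left, hd, sub_add_cancel]
    have h4 : -inner ℝ g d ≤ B * ‖d‖ := by
      have := neg_le_abs (inner ℝ g d)
      exact this.trans ((abs_real_inner_le_norm _ _).trans
        (mul_le_mul_of_nonneg_right hgB (norm_nonneg _)))
    -- Here `c * κ ≤ 1` lets the regularizer, with ridge `lam`, pay for the larger ridge `lam * κ`
    -- inside `V`.
    have h5 : c / ρ * (lam * κ * ‖d‖ ^ 2) ≤ lam * ‖d‖ ^ 2 := by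
      have : c / ρ * κ ≤ 1 := le_trans
        (mul_le_mul_of_nonneg_right (div_le_self hc0.le hρ1) hκ0.le) hcκ
      calc c / ρ * (lam * κ * ‖d‖ ^ 2) = (c / ρ * κ) * (lam * ‖d‖ ^ 2) := by ring
        _ ≤ 1 * (lam * ‖d‖ ^ 2) := mul_le_mul_of_nonneg_right this (by positivity)
        _ = _ := one_mul _
    have h6 : lam * (B * ‖d‖) ≤ √lam * B * V := by
      calc lam * (B * ‖d‖) = √lam * B * (√lam * ‖d‖) := by
            conv_lhs => rw [← Real.mul_self_sqrt hlam.le]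
            ring
        _ ≤ _ := mul_le_mul_of_nonneg_left hdV (by positivity)
    have h7 : Q * √S ≤ Q * V := mul_le_mul_of_nonneg_left hSV hQ
    have h8 := mul_le_mul_of_nonneg_right hK hV0
    have h9 := mul_le_mul_of_nonneg_left h4 hlam.le
    rw [hVsq, mul_add]
    rw [h3] at h1
    linarith
  have hVρ : V ≤ K * ρ := by
    rcases hV0.eq_or_lt with h0 | h0
    · rw [← h0]; positivity
    · have h1 : c * V * V ≤ c * V * (K * ρ) := by
        have := mul_le_mul_of_nonneg_left hmain (show 0 ≤ ρ by linarith)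
        have e : ρ * (c / ρ * V ^ 2) = c * V * V := by field_simp
        rw [e] at this
        linarith
      exact le_of_mul_le_mul_left h1 (by positivity)
  -- The branch `ρ = V * τ` gives `V ≤ K τ V`, which `K * τ < 1` excludes for `V > 0`.
  have hVK : V ≤ K := by
    rcases le_total (V * τ) 1 with h1 | h1
    · rw [hρ, max_eq_left h1] at hVρ; linarith
    · rw [hρ, max_eq_right h1] at hVρ
      nlinarith
  refine ⟨?_, fun i => (hdi i).trans (mul_le_mul_of_nonneg_right hVK hτ)⟩
  have : V ^ 2 ≤ K ^ 2 := pow_le_pow_left₀ hV0 hVK 2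
  have h0 : 0 ≤ lam * κ * ‖d‖ ^ 2 := by positivity
  linarith

/-- The refined error of the maximum likelihood estimate at a point `w`, in terms of the weighted
representer `v` of evaluation at `w`. -/
theorem mle_error_refined {lam κ B ν K τ s : ℝ} (hlam : 0 < lam) (hκ : 0 < κ) {n : ℕ}
    {pts : Fin n → X × X} {g h v : E} {w : X × X} {ε : Fin n → ℝ}
    (hopt : ∀ v, ∑ i, (Real.sigmoid (inner ℝ (ψ (pts i)) h) -
        Real.sigmoid (inner ℝ (ψ (pts i)) g)) * inner ℝ (ψ (pts i)) v + lam * inner ℝ h v =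
      ∑ i, ε i * inner ℝ (ψ (pts i)) v)
    (hgB : ‖g‖ ≤ B) (hK0 : 0 ≤ K) (hτ : 0 ≤ τ) (hν : 0 ≤ ν)
    (hd2 : ∑ i, inner ℝ (ψ (pts i)) (h - g) ^ 2 ≤ K ^ 2)
    (hdi : ∀ i, |inner ℝ (ψ (pts i)) (h - g)| ≤ K * τ)
    (hv : ∀ e, ∑ i, deriv Real.sigmoid (inner ℝ (ψ (pts i)) g) *
        (inner ℝ (ψ (pts i)) v * inner ℝ (ψ (pts i)) e) + lam * inner ℝ v e = inner ℝ (ψ w) e)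
    (hvnorm : lam * ‖v‖ ^ 2 ≤ inner ℝ (ψ w) v)
    (hvsum : ∑ i, inner ℝ (ψ (pts i)) v ^ 2 ≤ κ * inner ℝ (ψ w) v)
    (hs0 : 0 ≤ s) (hs : lam * inner ℝ (ψ w) v ≤ s ^ 2)
    (hnoise : |∑ i, ε i * inner ℝ (ψ (pts i)) v| ≤ ν * √(∑ i, inner ℝ (ψ (pts i)) v ^ 2)) :
    |inner ℝ (ψ w) h - inner ℝ (ψ w) g| ≤ (B + √(κ / lam) * (ν + K ^ 2 * τ)) * s := by
  have hB : 0 ≤ B := (norm_nonneg g).trans hgB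
  have hlam' : 0 < √lam := Real.sqrt_pos.2 hlam
  set r := inner ℝ (ψ w) v with hr
  have hr0 : 0 ≤ r := le_trans (by positivity) hvnorm
  have hrs : √lam * √r ≤ s := by
    rw [← Real.sqrt_mul hlam.le]
    exact Real.sqrt_le_iff.2 ⟨hs0, hs⟩
  have hvn : √lam * ‖v‖ ≤ √r := by
    refine Real.le_sqrt_of_sq_le ?_
    rwa [mul_pow, Real.sq_sqrt hlam.le]
  have hvs : √(∑ i, inner ℝ (ψ (pts i)) v ^ 2) ≤ √κ * √r := by
    rw [← Real.sqrt_mul hκ.le]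
    exact Real.sqrt_le_sqrt hvsum
  have hκs : √κ * √r ≤ √(κ / lam) * s := by
    rw [Real.sqrt_div hκ.le, div_mul_eq_mul_div, le_div_iff₀ hlam', mul_assoc]
    exact mul_le_mul_of_nonneg_left (by linarith) (Real.sqrt_nonneg _)
  choose α hα1 hα2 using fun i => exists_sigmoid_slope (inner ℝ (ψ (pts i)) h)
    (inner ℝ (ψ (pts i)) g)
  have hdiff : ∀ i, inner ℝ (ψ (pts i)) h - inner ℝ (ψ (pts i)) g =
      inner ℝ (ψ (pts i)) (h - g) := fun i => (inner_sub_right _ _ _).symm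
  simp only [hdiff] at hα1 hα2
  -- Noise, bias and remainder. Subtract the optimality equation tested with `v`, whose slopes are
  -- the secants `α`, from the representer equation tested with `h - g`, whose slopes are the
  -- derivatives at `g`.
  have hdecomp : inner ℝ (ψ w) h - inner ℝ (ψ w) g =
      ∑ i, ε i * inner ℝ (ψ (pts i)) v + -(lam * inner ℝ g v) +
      ∑ i, (deriv Real.sigmoid (inner ℝ (ψ (pts i)) g) - α i) *
        (inner ℝ (ψ (pts i)) (h - g) * inner ℝ (ψ (pts i)) v) := by
    rw [← inner_sub_right, ← hv (h - g), ← hopt v]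
    have e : inner ℝ v (h - g) = inner ℝ h v - inner ℝ g v := by
      rw [real_inner_comm, inner_sub_left]
    simp only [hα1, e]
    have : ∀ i, (deriv Real.sigmoid (inner ℝ (ψ (pts i)) g) - α i) *
        (inner ℝ (ψ (pts i)) (h - g) * inner ℝ (ψ (pts i)) v) =
        deriv Real.sigmoid (inner ℝ (ψ (pts i)) g) *
        (inner ℝ (ψ (pts i)) v * inner ℝ (ψ (pts i)) (h - g)) -
        α i * inner ℝ (ψ (pts i)) (h - g) * inner ℝ (ψ (pts i)) v := fun i => by ring
    simp only [this, Finset.sum_sub_distrib]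
    ring
  have hbias : |-(lam * inner ℝ g v)| ≤ B * s := by
    rw [abs_neg, abs_mul, abs_of_pos hlam]
    calc lam * |inner ℝ g v| ≤ lam * (B * ‖v‖) := by
          refine mul_le_mul_of_nonneg_left ((abs_real_inner_le_norm _ _).trans
            (mul_le_mul_of_nonneg_right hgB (norm_nonneg _))) hlam.le
      _ = B * (√lam * (√lam * ‖v‖)) := by
          conv_lhs => rw [← Real.mul_self_sqrt hlam.le]
          ring
      _ ≤ B * (√lam * √r) := by gcongr
      _ ≤ B * s := by gcongr
  have hrem : |∑ i, (deriv Real.sigmoid (inner ℝ (ψ (pts i)) g) - α i) *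
      (inner ℝ (ψ (pts i)) (h - g) * inner ℝ (ψ (pts i)) v)| ≤
      K ^ 2 * τ * (√(κ / lam) * s) := by
    calc _ ≤ ∑ i, K * τ * (|inner ℝ (ψ (pts i)) (h - g)| * |inner ℝ (ψ (pts i)) v|) := by
          refine (Finset.abs_sum_le_sum_abs _ _).trans (Finset.sum_le_sum fun i _ => ?_)
          rw [abs_mul, abs_mul]
          refine mul_le_mul_of_nonneg_right ?_ (by positivity)
          rw [abs_sub_comm]
          exact (hα2 i).trans (hdi i)
      _ = K * τ * ∑ i, |inner ℝ (ψ (pts i)) (h - g)| * |inner ℝ (ψ (pts i)) v| := by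
          rw [Finset.mul_sum]
      _ ≤ K * τ * (K * (√(κ / lam) * s)) := by
          refine mul_le_mul_of_nonneg_left ?_ (by positivity)
          refine (Real.sum_mul_le_sqrt_mul_sqrt _ _ _).trans ?_
          simp only [sq_abs]
          refine mul_le_mul (Real.sqrt_le_iff.2 ⟨hK0, hd2⟩) (hvs.trans hκs)
            (Real.sqrt_nonneg _) hK0
      _ = _ := by ring
  have hfirst := hnoise.trans (mul_le_mul_of_nonneg_left (hvs.trans hκs) hν)
  rw [hdecomp]
  refine (abs_add_three _ _ _).trans ((add_le_add (add_le_add hfirst hbias) hrem).trans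
    (le_of_eq (by ring)))

end Round

/-- Confidence bound for the regularized maximum likelihood estimate from one round of queries. -/
theorem round_confidence {X D : Type*} [Fintype X] [DecidableEq X] [NormedAddCommGroup D]
    [InnerProductSpace ℝ D] [CompleteSpace D] [RKHS ℝ D (X × X) ℝ] {u : X → ℝ} {g h v : D}
    {lam B κ c K τ ν ℓ : ℝ} (hlam : 0 < lam) (hκ : 1 ≤ κ)
    (hg : ∀ p : X × X, g p = u p.1 - u p.2) (hgB : ‖g‖ ≤ B)
    (hub : ∀ x x', |u x - u x'| ≤ 2 * B) {N : ℕ} {pts : Fin N → X × X} {obs : Fin N → Bool}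
    (hmin : IsMinOn (logisticLoss (D := D) lam pts obs) Set.univ h)
    (hc0 : 0 < c) (hc : c ≤ deriv Real.sigmoid (2 * B + 1)) (hcκ : c * κ ≤ 1) (hℓ : 0 ≤ ℓ)
    (hK : √(Fintype.card (X × X) * (ℓ / 2)) + √lam * B ≤ K * c) (hK0 : 0 ≤ K) (hτ : 0 ≤ τ)
    (hKτ : K * τ < 1) (hν : 0 ≤ ν)
    (hcurv : ∀ i, 1 / κ ≤ deriv Real.sigmoid (g (pts i)))
    (hunc : ∀ i, uncertainty (realKernel D) (lam * κ) pts (pts i) ^ 2 ≤ lam * κ * τ ^ 2)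
    (hrough : ∀ p, |∑ i, (if pts i = p then 1 else 0) * feedbackError u (obs i) (pts i)| ≤
      √(ℓ / 2 * ∑ i, (if pts i = p then (1 : ℝ) else 0) ^ 2)) {w : X × X}
    (hv : ∀ e : D, ∑ i, deriv Real.sigmoid (g (pts i)) * (v (pts i) * e (pts i)) +
      lam * inner ℝ v e = e w)
    (hvnorm : lam * ‖v‖ ^ 2 ≤ v w)
    (hvκ : (∀ i, 1 / κ ≤ deriv Real.sigmoid (g (pts i))) → ∑ i, v (pts i) ^ 2 ≤ κ * v w ∧
      lam * v w ≤ uncertainty (realKernel D) (lam * κ) pts w ^ 2)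
    (hfine : |∑ i, v (pts i) * feedbackError u (obs i) (pts i)| ≤ ν * √(∑ i, v (pts i) ^ 2)) :
    |h w - g w| ≤ (B + √(κ / lam) * (ν + K ^ 2 * τ)) *
      uncertainty (realKernel D) (lam * κ) pts w := by
  set ψ : X × X → D := fun p => RKHS.kerFun D p (1 : ℝ) with hψ
  have heval : ∀ (p : X × X) (e : D), inner ℝ (ψ p) e = e p := fun p e => inner_kerFun_one p e
  have hq : ∀ p p', realKernel D p p' = inner ℝ (ψ p) (ψ p') := realKernel_eq_inner
  set ε : Fin N → ℝ := fun i => feedbackError u (obs i) (pts i) with hε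
  have hopt : ∀ e : D, ∑ i, (Real.sigmoid (inner ℝ (ψ (pts i)) h) -
      Real.sigmoid (inner ℝ (ψ (pts i)) g)) * inner ℝ (ψ (pts i)) e + lam * inner ℝ h e =
      ∑ i, ε i * inner ℝ (ψ (pts i)) e := by
    intro e
    have h1 := logisticLoss_optimality hmin e
    simp only [heval]
    rw [← sub_eq_zero, ← h1, add_sub_right_comm, ← Finset.sum_sub_distrib]
    congr 1
    refine Finset.sum_congr rfl fun i _ => ?_
    simp only [hε, feedbackError, prefProb, hg]
    ring
  have hnoise : ∀ e : D, |∑ i, ε i * inner ℝ (ψ (pts i)) e| ≤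
      √(Fintype.card (X × X) * (ℓ / 2)) * √(∑ i, inner ℝ (ψ (pts i)) e ^ 2) := fun e =>
    abs_sum_mul_le_of_grouped pts ε (by positivity) hrough fun p => inner ℝ (ψ p) e
  obtain ⟨hd2, hdi⟩ := mle_error_rough hq hlam hκ hopt hgB
    (fun i => by rw [heval, hg]; exact hub _ _) hc0 hc hcκ hnoise (Real.sqrt_nonneg _) hK hτ hKτ
    hunc
  obtain ⟨hvsum, hvs⟩ := hvκ hcurv
  have := mle_error_refined (ψ := ψ) (w := w) (v := v) (κ := κ) (ν := ν)
    (s := uncertainty (realKernel D) (lam * κ) pts w) hlam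
    (by linarith) hopt hgB hK0 hτ hν hd2 hdi (fun e => by simp only [heval]; exact hv e)
    (by rw [heval]; exact hvnorm) (by simp only [heval]; exact hvsum) (uncertainty_nonneg _ _ _)
    (by rw [heval]; exact hvs) (by
      simp only [heval]
      refine le_of_eq_of_le (congrArg abs (Finset.sum_congr rfl fun i _ => mul_comm _ _)) hfine)
  simpa only [heval] using this

/-! ### Simultaneous noise control over all rounds -/

section Concentration

variable {X Ω D : Type*} [Fintype X] [NormedAddCommGroup D] [InnerProductSpace ℝ D]
    [CompleteSpace D] [RKHS ℝ D (X × X) ℝ] {mΩ : MeasurableSpace Ω} {P : Measure Ω}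
    {ℱ : Filtration ℕ mΩ} {u : X → ℝ} {lam B δ : ℝ} {T : ℕ} {z : ℕ → Ω → X × X}
    {y : ℕ → Ω → Bool} {M : ℕ → Ω → Set X} {h : ℕ → Ω → D}

/-- Simultaneous deviation bound for finitely many weighted noise sums in every round. -/
theorem IsMRLPF.noise_bound [IsProbabilityMeasure P] (hB : IsBTLFeedback P ℱ u T z y)
    (hM : IsMRLPF ℱ u lam B δ T z y M h) {ι : Type*} [Fintype ι]
    (W : ∀ r, ι → (Fin (roundSize T r) → X × X) → Fin (roundSize T r) → ℝ) {ℓ : ι → ℝ}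
    (hℓ : ∀ k, 0 < ℓ k) :
    P.real {ω | ∃ r, 1 ≤ r ∧ r ≤ numRounds T ∧ ∃ k,
      √(ℓ k / 2 * ∑ i, W r k (roundQueries T r (roundSize T r) z ω) i ^ 2) <
        |∑ i, W r k (roundQueries T r (roundSize T r) z ω) i *
          feedbackError u (roundFeedback T r (roundSize T r) y ω i)
            (roundQueries T r (roundSize T r) z ω i)|} ≤
      numRounds T * ∑ k, 2 * Real.exp (-ℓ k) := by
  -- The factor `a` is used with the values `1` and `-1` to make the one-sided Hoeffding bound
  -- two-sided.
  set S : ℕ → ι → ℝ → Set Ω := fun r k a => {ω |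
    √(ℓ k / 2 * ∑ i, (a * W r k (roundQueries T r (roundSize T r) z ω) i) ^ 2) <
      ∑ i, (a * W r k (roundQueries T r (roundSize T r) z ω) i) *
        feedbackError u (roundFeedback T r (roundSize T r) y ω i)
          (roundQueries T r (roundSize T r) z ω i)} with hS
  have hprob : ∀ r ∈ Finset.Icc 1 (numRounds T), ∀ k a, P.real (S r k a) ≤ Real.exp (-ℓ k) := by
    intro r hr k a
    obtain ⟨hr1, hr2⟩ := Finset.mem_Icc.1 hr
    exact hB.hoeffding (n := roundSize T r) (t := roundEnd T (r - 1))
      (by rw [roundEnd_pred_add hr1]; exact roundEnd_le T r)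
      (fun i hi p => hM.select_meas r hr1 hr2 i hi p) (fun pts i => a * W r k pts i) (hℓ k)
  calc _ ≤ P.real (⋃ r ∈ Finset.Icc 1 (numRounds T), ⋃ k, (S r k 1 ∪ S r k (-1))) := by
        refine measureReal_mono ?_ (measure_ne_top _ _)
        rintro ω ⟨r, hr1, hr2, k, hk⟩
        simp only [Set.mem_iUnion]
        refine ⟨r, Finset.mem_Icc.2 ⟨hr1, hr2⟩, k, ?_⟩
        rcases lt_abs.1 hk with h1 | h1
        · left
          simpa only [hS, Set.mem_ofPred_eq, one_mul] using h1
        · right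
          simpa only [hS, Set.mem_ofPred_eq, neg_mul, one_mul, neg_sq,
            Finset.sum_neg_distrib] using h1
    _ ≤ ∑ r ∈ Finset.Icc 1 (numRounds T), P.real (⋃ k, (S r k 1 ∪ S r k (-1))) :=
        measureReal_biUnion_finset_le _ _
    _ ≤ ∑ r ∈ Finset.Icc 1 (numRounds T), ∑ k, 2 * Real.exp (-ℓ k) := by
        refine Finset.sum_le_sum fun r hr => (measureReal_iUnion_fintype_le _).trans
          (Finset.sum_le_sum fun k _ => (measureReal_union_le _ _).trans ?_)
        linarith [hprob r hr k 1, hprob r hr k (-1)]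
    _ = _ := by simp

end Concentration

/-! ### Choice of the horizon -/

theorem eventually_add_mul_log_le_rpow (A C : ℝ) {s : ℝ} (hs : 0 < s) :
    ∀ᶠ x : ℝ in Filter.atTop, A + C * Real.log x ≤ x ^ s := by
  have h1 := ((isLittleO_log_rpow_atTop hs).const_mul_left C).bound
    (show (0 : ℝ) < 1 / 2 by norm_num)
  have h2 := (tendsto_rpow_atTop hs).eventually_ge_atTop (2 * A)
  filter_upwards [h1, h2, Filter.eventually_ge_atTop (0 : ℝ)] with x hx1 hx2 hx3
  rw [Real.norm_eq_abs, Real.norm_eq_abs, abs_of_nonneg (Real.rpow_nonneg hx3 s)] at hx1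
  have := le_abs_self (C * Real.log x)
  linarith

/-- Take `m` just below `√T / (2p)`. It exceeds `T^(1/4)` for large `T`, so `√m` is at least
`T^(1/8)` and beats any affine function of `log T`. -/
theorem eventually_exists_sqrt_ge (A C : ℝ) {p : ℝ} (hp : 1 ≤ p) :
    ∀ᶠ T : ℕ in Filter.atTop, ∃ m : ℕ, 0 < m ∧ p * m < √(T : ℝ) / 2 ∧
      A + C * Real.log T ≤ √(m : ℝ) := by
  have h1 := (eventually_add_mul_log_le_rpow A C (show (0 : ℝ) < 1 / 8 by norm_num))
  have h2 := (tendsto_rpow_atTop (show (0 : ℝ) < 1 / 4 by norm_num)).eventually_ge_atTop (4 * p)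
  have h3 : ∀ᶠ x : ℝ in Filter.atTop, A + C * Real.log x ≤ x ^ (1 / 8 : ℝ) ∧
      4 * p ≤ x ^ (1 / 4 : ℝ) ∧ 0 ≤ x := by
    filter_upwards [h1, h2, Filter.eventually_ge_atTop (0 : ℝ)] with x a b c
    exact ⟨a, b, c⟩
  filter_upwards [tendsto_natCast_atTop_atTop.eventually h3] with T hT
  obtain ⟨ha, hb, hc⟩ := hT
  set w := (T : ℝ) ^ (1 / 4 : ℝ) with hw
  have hw2 : √(T : ℝ) = w ^ 2 := by
    rw [Real.sqrt_eq_rpow, hw, ← Real.rpow_natCast, ← Real.rpow_mul hc]; norm_num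
  have hw8 : (T : ℝ) ^ (1 / 8 : ℝ) = √w := by
    rw [Real.sqrt_eq_rpow, hw, ← Real.rpow_mul hc]; norm_num
  have hp0 : 0 < p := by linarith
  have hbig : w + 1 ≤ w ^ 2 / (2 * p) := by
    rw [le_div_iff₀ (by positivity)]
    nlinarith
  have hceil := Nat.ceil_lt_add_one (show 0 ≤ w ^ 2 / (2 * p) by positivity)
  have hceil2 := Nat.le_ceil (w ^ 2 / (2 * p))
  have hone : 1 ≤ ⌈w ^ 2 / (2 * p)⌉₊ := Nat.one_le_ceil_iff.2 (by linarith)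
  have hcast : ((⌈w ^ 2 / (2 * p)⌉₊ - 1 : ℕ) : ℝ) = ⌈w ^ 2 / (2 * p)⌉₊ - 1 := by
    rw [Nat.cast_sub hone, Nat.cast_one]
  have hwm : w ≤ ((⌈w ^ 2 / (2 * p)⌉₊ - 1 : ℕ) : ℝ) := by rw [hcast]; linarith
  -- The ceiling minus one, rather than the floor, makes the pigeonhole inequality strict.
  refine ⟨⌈w ^ 2 / (2 * p)⌉₊ - 1, ?_, ?_, ?_⟩
  · have : (0 : ℝ) < ((⌈w ^ 2 / (2 * p)⌉₊ - 1 : ℕ) : ℝ) := by linarith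
    exact_mod_cast this
  · rw [hcast, hw2]
    have : (⌈w ^ 2 / (2 * p)⌉₊ : ℝ) - 1 < w ^ 2 / (2 * p) := by linarith
    have h5 := mul_lt_mul_of_pos_left this hp0
    refine h5.trans_eq ?_
    field_simp
  · rw [hw8] at ha
    exact ha.trans (Real.sqrt_le_sqrt hwm)

/-- For large horizons, a round with `√T / 2` samples determines the utilities well enough. -/
theorem eventually_horizon {p n lam B δ κ c : ℝ} (hp : 1 ≤ p) (hn : 1 ≤ n) (hlam : 0 < lam)
    (hB : 0 < B) (hδ0 : 0 < δ) (hδ1 : δ < 1) (hκ : 0 < κ) (hc : 0 < c) :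
    ∀ᶠ T : ℕ in Filter.atTop, 100 ≤ T ∧ ∃ m : ℕ, 0 < m ∧ p * m < √(T : ℝ) / 2 ∧
      ((√(p * (Real.log (4 * T * p / δ) / 2)) + √lam * B) / c) ^ 2 ≤ √(m : ℝ) / 10 ∧
      (√(p * (Real.log (4 * T * p / δ) / 2)) + √lam * B) / c < √(m : ℝ) ∧
      1 / 2 * (B + √(κ / lam * Real.log (2 * T * n / δ))) * √(lam * κ) ≤ 28 / 100 * √(m : ℝ) := by
  have hb1 : 0 ≤ Real.log (4 * p / δ) :=
    Real.log_nonneg (by rw [le_div_iff₀ hδ0]; linarith)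
  have hb2 : 0 ≤ Real.log (2 * n / δ) :=
    Real.log_nonneg (by rw [le_div_iff₀ hδ0]; linarith)
  set A₁ := 20 / c ^ 2 * (p * Real.log (4 * p / δ) / 2 + lam * B ^ 2)
  set C₁ := 20 / c ^ 2 * (p / 2)
  set A₂ := 2 * √(lam * κ) * (B + 1 + κ / lam * Real.log (2 * n / δ))
  set C₂ := 2 * √(lam * κ) * (κ / lam)
  have hA₁ : 0 ≤ A₁ := by positivity
  have hC₁ : 0 ≤ C₁ := by positivity
  have hA₂ : 0 ≤ A₂ := by positivity
  have hC₂ : 0 ≤ C₂ := by positivity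
  filter_upwards [eventually_exists_sqrt_ge (A₁ + A₂) (C₁ + C₂) hp,
    Filter.eventually_ge_atTop 100] with T hT hT100
  obtain ⟨m, hm, hpm, hmain⟩ := hT
  have hT0 : (0 : ℝ) < T := by exact_mod_cast (by omega : 0 < T)
  have hlogT : 0 ≤ Real.log (T : ℝ) := Real.log_natCast_nonneg T
  have hl1 : Real.log (4 * T * p / δ) = Real.log (4 * p / δ) + Real.log T := by
    rw [← Real.log_mul (by positivity) hT0.ne']; congr 1; ring
  have hl2 : Real.log (2 * T * n / δ) = Real.log (2 * n / δ) + Real.log T := by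
    rw [← Real.log_mul (by positivity) hT0.ne']; congr 1; ring
  have hm1 : 1 ≤ √(m : ℝ) := Real.one_le_sqrt.2 (by exact_mod_cast hm)
  have h1 : 0 ≤ C₁ * Real.log T := by positivity
  have h2 : 0 ≤ C₂ * Real.log T := by positivity
  have hK : ((√(p * (Real.log (4 * T * p / δ) / 2)) + √lam * B) / c) ^ 2 ≤ √(m : ℝ) / 10 := by
    rw [hl1]
    set ℓ := Real.log (4 * p / δ) + Real.log T with hℓ
    have hsq : (√(p * (ℓ / 2)) + √lam * B) ^ 2 ≤ 2 * (p * (ℓ / 2) + lam * B ^ 2) := by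
      have e1 : √(p * (ℓ / 2)) ^ 2 = p * (ℓ / 2) := Real.sq_sqrt (by positivity)
      have e2 : (√lam * B) ^ 2 = lam * B ^ 2 := by rw [mul_pow, Real.sq_sqrt hlam.le]
      exact add_sq_le.trans_eq (by rw [e1, e2])
    have e3 : 10 * (2 * (p * (ℓ / 2) + lam * B ^ 2) / c ^ 2) = A₁ + C₁ * Real.log T := by
      simp only [A₁, C₁, hℓ]; ring
    have h4 : (√(p * (ℓ / 2)) + √lam * B) ^ 2 / c ^ 2 ≤
        2 * (p * (ℓ / 2) + lam * B ^ 2) / c ^ 2 := by gcongr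
    rw [div_pow]
    linarith
  refine ⟨hT100, m, hm, hpm, hK, ?_, ?_⟩
  · generalize (√(p * (Real.log (4 * T * p / δ) / 2)) + √lam * B) / c = K at hK
    -- From `2K ≤ K² + 1`, `K² ≤ √m / 10` and `1 ≤ √m`.
    have := sq_nonneg (K - 1)
    linarith [sub_sq K 1]
  · rw [hl2]
    set ℓ := Real.log (2 * n / δ) + Real.log T with hℓ
    have hsq : √(κ / lam * ℓ) ≤ 1 + κ / lam * ℓ := by
      refine Real.sqrt_le_iff.2 ⟨by positivity, ?_⟩
      have : 0 ≤ κ / lam * ℓ := by positivity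
      nlinarith
    have h5 : 2 * √(lam * κ) * (B + √(κ / lam * ℓ)) ≤ A₂ + C₂ * Real.log T := by
      have e : A₂ + C₂ * Real.log T = 2 * √(lam * κ) * (B + (1 + κ / lam * ℓ)) := by
        simp only [A₂, C₂, hℓ]; ring
      rw [e]
      gcongr
    linarith

/-! ### Accuracy, elimination and uncertainty along a run -/

/-- Near-optimal actions are almost tied, so the link function has slope at least `1 / 6`. -/
theorem one_sixth_le_deriv_sigmoid {X : Type*} {u : X → ℝ} {xstar x x' : X}
    (hx : u x ≤ u xstar) (hx' : u x' ≤ u xstar)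
    (h : prefProb u xstar x - 1 / 2 ≤ 28 / 100) (h' : prefProb u xstar x' - 1 / 2 ≤ 28 / 100) :
    1 / 6 ≤ deriv Real.sigmoid (u x - u x') := by
  rw [prefProb] at h h'
  have h1 : Real.sigmoid (u x - u x') ≤ Real.sigmoid (u xstar - u x') :=
    Real.sigmoid_le (by linarith)
  have h2 : Real.sigmoid (-(u xstar - u x)) ≤ Real.sigmoid (u x - u x') :=
    Real.sigmoid_le (by linarith)
  rw [Real.sigmoid_neg] at h2
  rw [deriv_sigmoid_apply]
  -- The sigmoid value lies in `[0.22, 0.78]`, and `0.22 * 0.78 = 0.1716 > 1 / 6`.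
  nlinarith

/-- The squared norm of the sum of the two kernel functions expands to zero under the dueling
kernel. Hence every function in `D` is antisymmetric. -/
theorem kerFun_swap {X : Type*} {H : Type*} [NormedAddCommGroup H] [InnerProductSpace ℝ H]
    [CompleteSpace H] [RKHS ℝ H X ℝ] {D : Type*} [NormedAddCommGroup D]
    [InnerProductSpace ℝ D] [CompleteSpace D] [RKHS ℝ D (X × X) ℝ]
    (hD : ∀ z w : X × X, realKernel D z w = duelingKernel (realKernel H) z w) (x x' : X) :
    RKHS.kerFun D (x', x) (1 : ℝ) = -RKHS.kerFun D (x, x') (1 : ℝ) := by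
  rw [← add_eq_zero_iff_eq_neg, ← norm_eq_zero, ← sq_eq_zero_iff, ← real_inner_self_eq_norm_sq]
  simp only [inner_add_left, inner_add_right, ← realKernel_eq_inner, hD, duelingKernel]
  ring

theorem roundCurvature_one {X : Type*} (u : X → ℝ) : roundCurvature u 1 = curvature u := if_pos rfl

theorem roundCurvature_of_two_le {X : Type*} (u : X → ℝ) {r : ℕ} (hr : 2 ≤ r) :
    roundCurvature u r = 6 := if_neg (by omega)

section Run

variable {X Ω D : Type*} [Fintype X] [NormedAddCommGroup D] [InnerProductSpace ℝ D]
    [CompleteSpace D] [RKHS ℝ D (X × X) ℝ] {mΩ : MeasurableSpace Ω}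
    {ℱ : Filtration ℕ mΩ} {u : X → ℝ} {lam B δ : ℝ} {T : ℕ} {z : ℕ → Ω → X × X}
    {y : ℕ → Ω → Bool} {M : ℕ → Ω → Set X} {h : ℕ → Ω → D}

theorem IsMRLPF.uncertainty_le (hM : IsMRLPF ℱ u lam B δ T z y M h) {r : ℕ} (hr1 : 1 ≤ r)
    (hr : r ≤ numRounds T) {ω : Ω} {w : X × X} (hw : w ∈ M r ω ×ˢ M r ω) {n : ℕ}
    (hn : n < roundSize T r) :
    uncertainty (realKernel D) (lam * roundCurvature u r)
        (fun j : Fin n => z (roundEnd T (r - 1) + j) ω) w ≤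
      uncertainty (realKernel D) (lam * roundCurvature u r)
        (fun j : Fin n => z (roundEnd T (r - 1) + j) ω) (z (roundEnd T (r - 1) + n) ω) :=
  isMaxOn_iff.1 (hM.select r hr1 hr n hn ω ⟨w.1, hw.1⟩).2 w hw

theorem IsMRLPF.mul_roundUncertainty_sq_le (hM : IsMRLPF ℱ u lam B δ T z y M h) {r : ℕ}
    (hr1 : 1 ≤ r) (hr : r ≤ numRounds T) {ω : Ω} {w : X × X} (hw : w ∈ M r ω ×ˢ M r ω) {m : ℕ}
    (hm : Fintype.card (X × X) * m < roundSize T r) (ha : 0 < lam * roundCurvature u r) :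
    (m : ℝ) * roundUncertainty (realKernel D) u lam T r (roundSize T r) z ω w ^ 2 ≤
      lam * roundCurvature u r :=
  mul_uncertainty_sq_le_of_card (realKernel_eq_inner (H := D)) ha
    (fun j => z (roundEnd T (r - 1) + j) ω) hm w fun _ hn => hM.uncertainty_le hr1 hr hw hn

/-- The estimate at the end of a round is accurate on the pairs that contain the best action. -/
theorem IsMRLPF.round_error [DecidableEq X] [Nonempty X] (hM : IsMRLPF ℱ u lam B δ T z y M h)
    {g v : D} {c K ℓ : ℝ} (hlam : 0 < lam) (hB : 0 < B) (hδ0 : 0 < δ) (hδ1 : δ < 1)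
    (hg : ∀ p : X × X, g p = u p.1 - u p.2) (hgB : ‖g‖ ≤ B)
    (hub : ∀ x x', |u x - u x'| ≤ 2 * B) {r : ℕ} (hr1 : 1 ≤ r) (hr : r ≤ numRounds T)
    (hR : 3 ≤ numRounds T) {ω : Ω} (hne : (M r ω).Nonempty) {m : ℕ} (hm0 : 0 < m)
    (hm : Fintype.card (X × X) * m < roundSize T r) (hκ : 1 ≤ roundCurvature u r)
    (hc0 : 0 < c) (hc : c ≤ deriv Real.sigmoid (2 * B + 1)) (hcκ : c * roundCurvature u r ≤ 1)
    (hℓ : 0 ≤ ℓ) (hK : √(Fintype.card (X × X) * (ℓ / 2)) + √lam * B ≤ K * c)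
    (hKm : K < √(m : ℝ)) (hK2 : K ^ 2 ≤ √(m : ℝ) / 10)
    (hcurv : ∀ x ∈ M r ω, ∀ x' ∈ M r ω,
      1 / roundCurvature u r ≤ deriv Real.sigmoid (u x - u x'))
    (hrough : ∀ p, |∑ i, (if roundQueries T r (roundSize T r) z ω i = p then 1 else 0) *
        feedbackError u (roundFeedback T r (roundSize T r) y ω i)
          (roundQueries T r (roundSize T r) z ω i)| ≤
      √(ℓ / 2 * ∑ i, (if roundQueries T r (roundSize T r) z ω i = p then (1 : ℝ) else 0) ^ 2))
    {w : X × X}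
    (hv : ∀ e : D, ∑ i, deriv Real.sigmoid (g (roundQueries T r (roundSize T r) z ω i)) *
        (v (roundQueries T r (roundSize T r) z ω i) * e (roundQueries T r (roundSize T r) z ω i)) +
      lam * inner ℝ v e = e w)
    (hvnorm : lam * ‖v‖ ^ 2 ≤ v w)
    (hvκ : (∀ i, 1 / roundCurvature u r ≤
        deriv Real.sigmoid (g (roundQueries T r (roundSize T r) z ω i))) →
      ∑ i, v (roundQueries T r (roundSize T r) z ω i) ^ 2 ≤ roundCurvature u r * v w ∧
      lam * v w ≤ uncertainty (realKernel D) (lam * roundCurvature u r)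
        (roundQueries T r (roundSize T r) z ω) w ^ 2)
    (hfine : |∑ i, v (roundQueries T r (roundSize T r) z ω i) *
        feedbackError u (roundFeedback T r (roundSize T r) y ω i)
          (roundQueries T r (roundSize T r) z ω i)| ≤
      √(3 / 2 * Real.log (2 * (numRounds T : ℝ) * (Fintype.card X : ℝ) / δ) / 2 *
        ∑ i, v (roundQueries T r (roundSize T r) z ω i) ^ 2)) :
    |Real.sigmoid (h r ω w) - prefProb u w.1 w.2| ≤ confWidth u lam B δ T r *
      roundUncertainty (realKernel D) u lam T r (roundSize T r) z ω w := by
  set κ := roundCurvature u r with hκdef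
  set Λ := Real.log (2 * (numRounds T : ℝ) * (Fintype.card X : ℝ) / δ) with hΛ
  have hκ0 : 0 < κ := by linarith
  have hm0' : (0 : ℝ) < m := by exact_mod_cast hm0
  have hsm : 0 < √(m : ℝ) := Real.sqrt_pos.2 hm0'
  have hmem : ∀ i, roundQueries T r (roundSize T r) z ω i ∈ M r ω ×ˢ M r ω := fun i =>
    (hM.select r hr1 hr i i.2 ω hne).1
  have hΛ1 : 1 ≤ Λ := by
    have h1 : Real.exp 1 ≤ 2 * (numRounds T : ℝ) * (Fintype.card X : ℝ) / δ := by
      have hR' : (3 : ℝ) ≤ numRounds T := by exact_mod_cast hR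
      have hX : (1 : ℝ) ≤ Fintype.card X := by exact_mod_cast Fintype.card_pos
      rw [le_div_iff₀ hδ0]
      have := Real.exp_one_lt_d9
      nlinarith [Real.exp_pos 1]
    exact (Real.le_log_iff_exp_le (lt_of_lt_of_le (Real.exp_pos 1) h1)).2 h1
  have hK0 : 0 ≤ K := by
    have : 0 ≤ K * c := le_trans (by positivity) hK
    exact nonneg_of_mul_nonneg_left this hc0
  have hmain := round_confidence (h := h r ω) (v := v) (w := w) (κ := κ) (c := c) (K := K)
    (τ := 1 / √(m : ℝ)) (ν := √(3 / 2 * Λ / 2)) (ℓ := ℓ) hlam hκ hg hgB hub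
    (hM.predict r hr1 hr ω) hc0 hc hcκ hℓ hK hK0 (by positivity)
    (by rw [mul_one_div, div_lt_one hsm]; exact hKm) (Real.sqrt_nonneg _)
    (fun i => by rw [hg]; exact hcurv _ (hmem i).1 _ (hmem i).2)
    (fun i => by
      have h1 := hM.mul_roundUncertainty_sq_le hr1 hr (hmem i) hm (mul_pos hlam hκ0)
      rw [div_pow, Real.sq_sqrt hm0'.le, one_pow, mul_one_div, le_div_iff₀ hm0', mul_comm]
      exact h1)
    hrough hv hvnorm hvκ
    (by rw [← Real.sqrt_mul (by positivity)]; exact hfine)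
  -- Noise takes `√(3Λ/4) ≤ 0.9 √Λ`, and the remainder takes at most `0.1 ≤ 0.1 √Λ`.
  have hwidth : B + √(κ / lam) * (√(3 / 2 * Λ / 2) + K ^ 2 * (1 / √(m : ℝ))) ≤
      B + √(κ / lam * Λ) := by
    rw [Real.sqrt_mul (by positivity)]
    have h1 : K ^ 2 * (1 / √(m : ℝ)) ≤ 1 / 10 := by
      rw [mul_one_div, div_le_iff₀ hsm]; linarith
    have hs1 : 1 ≤ √Λ := Real.one_le_sqrt.2 hΛ1
    have h2 : √(3 / 2 * Λ / 2) ≤ 9 / 10 * √Λ := by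
      refine Real.sqrt_le_iff.2 ⟨by positivity, ?_⟩
      rw [mul_pow, Real.sq_sqrt (by linarith)]
      linarith
    have h3 : √(3 / 2 * Λ / 2) + K ^ 2 * (1 / √(m : ℝ)) ≤ √Λ := by linarith
    have := mul_le_mul_of_nonneg_left h3 (Real.sqrt_nonneg (κ / lam))
    linarith
  have hunc0 : 0 ≤ uncertainty (realKernel D) (lam * κ)
    (roundQueries T r (roundSize T r) z ω) w := uncertainty_nonneg _ _ _
  rw [prefProb, ← hg w, confWidth, linkSlope_eq]
  refine (abs_sigmoid_sub_le _ _).trans ?_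
  rw [mul_assoc]
  exact mul_le_mul_of_nonneg_left (hmain.trans (mul_le_mul_of_nonneg_right hwidth hunc0))
    (by norm_num)

/-- If the estimate is accurate on the pairs that contain the best action, then the best action
survives the elimination, and the surviving actions are close to it. -/
theorem IsMRLPF.elimination (hM : IsMRLPF ℱ u lam B δ T z y M h) {H : Type*}
    [NormedAddCommGroup H] [InnerProductSpace ℝ H] [CompleteSpace H] [RKHS ℝ H X ℝ]
    (hD : ∀ z w : X × X, realKernel D z w = duelingKernel (realKernel H) z w) {r : ℕ}
    (hr1 : 1 ≤ r) (hr : r ≤ numRounds T) {ω : Ω} {xstar : X} (hstar : ∀ x, u x ≤ u xstar)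
    (hmem : xstar ∈ M r ω)
    (herr : ∀ x, |Real.sigmoid (h r ω (xstar, x)) - prefProb u xstar x| ≤
      confWidth u lam B δ T r *
        roundUncertainty (realKernel D) u lam T r (roundSize T r) z ω (xstar, x)) :
    xstar ∈ M (r + 1) ω ∧ ∀ x ∈ M (r + 1) ω, prefProb u xstar x - 1 / 2 ≤
      2 * (confWidth u lam B δ T r *
        roundUncertainty (realKernel D) u lam T r (roundSize T r) z ω (xstar, x)) := by
  rw [hM.update r hr1 hr ω]
  refine ⟨⟨hmem, fun x _ => ?_⟩, fun x hx => ?_⟩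
  · have h1 := (abs_le.1 (herr x)).1
    have h2 : 1 / 2 ≤ prefProb u xstar x := by
      rw [prefProb, one_div, ← Real.sigmoid_zero]
      exact Real.sigmoid_le (sub_nonneg.2 (hstar x))
    linarith
  -- A survivor `x` passed the test against `xstar`; antisymmetry of the estimate turns this into an
  -- upper bound on the estimated advantage of `xstar`.
  · have h1 := hx.2 xstar hmem
    have hψ := kerFun_swap hD xstar x
    have h2 : h r ω (x, xstar) = -h r ω (xstar, x) := by
      rw [← inner_kerFun_one, hψ, inner_neg_left, inner_kerFun_one]
    have h3 : roundUncertainty (realKernel D) u lam T r (roundSize T r) z ω (x, xstar) =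
        roundUncertainty (realKernel D) u lam T r (roundSize T r) z ω (xstar, x) :=
      uncertainty_congr_neg (realKernel_eq_inner (H := D)) _ _ hψ
    rw [h2, h3, Real.sigmoid_neg] at h1
    have h4 := (abs_le.1 (herr x)).1
    linarith

/-- The uncertainty at the end of a long round with ridge `6 λ`. -/
theorem IsMRLPF.roundUncertainty_le (hM : IsMRLPF ℱ u lam B δ T z y M h) (hlam : 0 < lam)
    (hq4 : ∀ p : X × X, realKernel D p p ≤ 4) {r : ℕ} (hr2 : 2 ≤ r) (hr : r ≤ numRounds T)
    {ω : Ω} {w : X × X} (hw : w ∈ M r ω ×ˢ M r ω) (hT : 0 < T)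
    (hN : T ≤ numRounds T * roundSize T r) :
    roundUncertainty (realKernel D) u lam T r (roundSize T r) z ω w ≤
      constC lam * √((numRounds T : ℝ) * maxInfoGain (realKernel D) (4 * lam) T / (T : ℝ)) := by
  have hq := realKernel_eq_inner (H := D)
  have hN0 : 0 < roundSize T r := one_le_roundSize (by omega) hr
  have hN0' : (0 : ℝ) < roundSize T r := by exact_mod_cast hN0
  have hT' : (0 : ℝ) < T := by exact_mod_cast hT
  have hΓ : 0 ≤ maxInfoGain (realKernel D) (4 * lam) T := by
    have := sum_log_le_maxInfoGain hq (show 0 < 4 * lam by linarith) le_rfl (fun _ => w)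
      (Nat.zero_le T)
    simp only [Finset.range_zero, Finset.sum_empty] at this
    linarith
  have h1 := uncertainty_sq_le_infoGain hq hq4 (a := 4 * lam) (a' := lam * roundCurvature u r)
    (by linarith) (by rw [roundCurvature_of_two_le u hr2]; linarith)
    (fun j => z (roundEnd T (r - 1) + j) ω) hN0 (roundSize_le T r (by omega)) w
    (fun n hn => hM.uncertainty_le (by omega) hr hw hn)
  have hlog : 0 < Real.log (1 + 4 * (6 * lam)⁻¹) := Real.log_pos (by
    have : 0 < 4 * (6 * lam)⁻¹ := by positivity
    linarith)
  have e1 : 1 + 4 / (lam * roundCurvature u r) = 1 + 4 * (6 * lam)⁻¹ := by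
    rw [roundCurvature_of_two_le u hr2, mul_comm lam, div_eq_mul_inv]
  rw [e1] at h1
  have h2 : maxInfoGain (realKernel D) (4 * lam) T / roundSize T r ≤
      (numRounds T : ℝ) * maxInfoGain (realKernel D) (4 * lam) T / (T : ℝ) := by
    rw [div_le_div_iff₀ hN0' hT']
    have : (T : ℝ) ≤ numRounds T * roundSize T r := by exact_mod_cast hN
    have := mul_le_mul_of_nonneg_left this hΓ
    linarith
  have hC0 : 0 ≤ constC lam := by rw [constC]; positivity
  refine (pow_le_pow_iff_left₀ (uncertainty_nonneg _ _ _) (by positivity) two_ne_zero).1 ?_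
  refine h1.trans ?_
  have e2 : constC lam ^ 2 = 8 / Real.log (1 + 4 * (6 * lam)⁻¹) := by
    rw [constC, mul_pow, Real.sq_sqrt (by positivity)]; ring
  rw [mul_pow, e2, Real.sq_sqrt (by positivity)]
  exact mul_le_mul_of_nonneg_left h2 (by positivity)

end Run

/-! ### Failure probability -/

/-- The rough events cost `δ R / (2T) ≤ δ / 2`. The sharp ones at level `Λ` alone would cost all of
`δ`; the level `3Λ/2` gains a factor `exp (-Λ/2) ≤ 1 / 2`. -/
theorem failure_budget {R T p n δ : ℝ} (hR : 2 ≤ R) (hRT : R ≤ T) (hp : 1 ≤ p) (hn : 1 ≤ n)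
    (hδ0 : 0 < δ) (hδ1 : δ < 1) :
    R * (p * (2 * Real.exp (-Real.log (4 * T * p / δ))) +
      n * (2 * Real.exp (-(3 / 2 * Real.log (2 * R * n / δ))))) ≤ δ := by
  have hT : 0 < T := by linarith
  have e1 : Real.exp (-Real.log (4 * T * p / δ)) = δ / (4 * T * p) := by
    rw [Real.exp_neg, Real.exp_log (by positivity), inv_div]
  set Λ := Real.log (2 * R * n / δ) with hΛ
  have e2 : Real.exp (-Λ) = δ / (2 * R * n) := by
    rw [Real.exp_neg, Real.exp_log (by positivity), inv_div]
  have hhalf : Real.exp (-(1 / 2 * Λ)) ≤ 1 / 2 := by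
    refine (pow_le_pow_iff_left₀ (Real.exp_pos _).le (by norm_num) two_ne_zero).1 ?_
    have : Real.exp (-(1 / 2 * Λ)) ^ 2 = Real.exp (-Λ) := by
      rw [← Real.exp_nat_mul]; congr 1; push_cast; ring
    rw [this, e2, div_le_iff₀ (by positivity)]
    nlinarith
  have e3 : Real.exp (-(3 / 2 * Λ)) = δ / (2 * R * n) * Real.exp (-(1 / 2 * Λ)) := by
    rw [← e2, ← Real.exp_add]; congr 1; ring
  rw [e1, e3]
  have e4 : R * (p * (2 * (δ / (4 * T * p))) +
      n * (2 * (δ / (2 * R * n) * Real.exp (-(1 / 2 * Λ))))) =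
      δ * (R / T * (1 / 2) + Real.exp (-(1 / 2 * Λ))) := by
    field_simp
    ring
  have h5 : R / T ≤ 1 := (div_le_one hT).2 hRT
  rw [e4]
  nlinarith

/-- A set whose complement has small outer measure has large measure. -/
theorem ofReal_one_sub_le_of_compl_subset {Ω : Type*} {mΩ : MeasurableSpace Ω} {P : Measure Ω}
    [IsProbabilityMeasure P] {S N : Set Ω} {δ : ℝ} (hN : P.real N ≤ δ) (hS : Sᶜ ⊆ N) :
    ENNReal.ofReal (1 - δ) ≤ P S := by
  have h1 : (1 : ℝ) ≤ P.real S + P.real N := by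
    rw [← probReal_univ (μ := P), ← Set.union_compl_self S]
    exact (measureReal_union_le _ _).trans (add_le_add_right (measureReal_mono hS) _)
  rw [← ofReal_measureReal (measure_ne_top _ _)]
  exact ENNReal.ofReal_le_ofReal (by linarith)

end BOHF

/-! ### Assembly of the theorem -/

open BOHF in
theorem corollary1 {X : Type*} [Fintype X] (lam B δ : ℝ) (hlam : 0 < lam) (hB : 0 < B)
    (hδ0 : 0 < δ) (hδ1 : δ < 1) :
    ∃ T₀ : ℕ, 0 < T₀ ∧ ∀ T : ℕ, T₀ ≤ T →
      ∀ (H : Type*) [NormedAddCommGroup H] [InnerProductSpace ℝ H] [CompleteSpace H]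
        [RKHS ℝ H X ℝ]
        (D : Type*) [NormedAddCommGroup D] [InnerProductSpace ℝ D] [CompleteSpace D]
        [RKHS ℝ D (X × X) ℝ],
      (∀ x x' : X, BOHF.realKernel H x x' ≤ 1) →
      (∀ z w : X × X, BOHF.realKernel D z w = BOHF.duelingKernel (BOHF.realKernel H) z w) →
      ∀ (f : H), ‖f‖ ≤ B →
      ∀ (xstar : X), (∀ x : X, f x ≤ f xstar) →
      ∀ (Ω : Type*) (mΩ : MeasurableSpace Ω) (P : Measure Ω) [IsProbabilityMeasure P]
        (ℱ : Filtration ℕ mΩ) (z : ℕ → Ω → X × X) (y : ℕ → Ω → Bool)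
        (M : ℕ → Ω → Set X) (h : ℕ → Ω → D),
      BOHF.IsBTLFeedback P ℱ f T z y →
      BOHF.IsMRLPF ℱ f lam B δ T z y M h →
      ENNReal.ofReal (1 - δ) ≤ P {ω | ∀ xhat ∈ M (BOHF.numRounds T + 1) ω,
        BOHF.prefProb f xstar xhat - 1 / 2 ≤
          2 * BOHF.confWidth f lam B δ T (BOHF.numRounds T) * BOHF.constC lam *
            √((BOHF.numRounds T : ℝ) *
              BOHF.maxInfoGain (BOHF.duelingKernel (BOHF.realKernel H)) (4 * lam) T / (T : ℝ))} :=
  by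
  classical
  rcases isEmpty_or_nonempty X with hX | hX
  · exact ⟨1, one_pos, fun _ _ _ _ _ _ _ _ _ _ _ _ _ _ _ _ xstar => isEmptyElim xstar⟩
  have hn : (1 : ℝ) ≤ Fintype.card X := by exact_mod_cast Fintype.card_pos
  have hp : (1 : ℝ) ≤ Fintype.card (X × X) := by exact_mod_cast Fintype.card_pos
  set κB := 1 / deriv Real.sigmoid (2 * B) with hκB
  have hκB0 : 0 < κB := one_div_pos.2 (deriv_sigmoid_pos _)
  -- Depends on `B` alone. The first entry is the slope within distance one of the range of `g`;
  -- both together give `c * κ_r ≤ 1` in every round.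
  set c := min (deriv Real.sigmoid (2 * B + 1)) (1 / 6) with hc
  have hc0 : 0 < c := lt_min (deriv_sigmoid_pos _) (by norm_num)
  obtain ⟨T₀, hT₀⟩ := Filter.eventually_atTop.1
    (eventually_horizon hp hn hlam hB hδ0 hδ1 hκB0 hc0)
  refine ⟨max T₀ 1, by positivity, ?_⟩
  intro T hT H _ _ _ _ D _ _ _ _ hk hD f hf xstar hstar Ω mΩ P _ ℱ z y M h hBTL hM
  obtain ⟨hT100, m, hm0, hpm, hK2, hKm, hfirst⟩ := hT₀ T ((le_max_left _ _).trans hT)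
  set ℓc := Real.log (4 * T * Fintype.card (X × X) / δ) with hℓc
  set K := (√(Fintype.card (X × X) * (ℓc / 2)) + √lam * B) / c with hK
  set R := numRounds T with hRdef
  have hR3 : 3 ≤ R := three_le_numRounds hT100
  have hRT : R ≤ T := numRounds_le T
  have hT1 : (1 : ℝ) ≤ T := by exact_mod_cast (by omega : 1 ≤ T)
  have hR2' : (2 : ℝ) ≤ R := by exact_mod_cast (by omega : 2 ≤ R)
  have hRT' : (R : ℝ) ≤ T := by exact_mod_cast hRT
  have hm0' : (0 : ℝ) < m := by exact_mod_cast hm0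
  have hsm : 0 < √(m : ℝ) := Real.sqrt_pos.2 hm0'
  set Λ := Real.log (2 * R * Fintype.card X / δ) with hΛ
  have hℓc0 : 0 < ℓc := Real.log_pos (by
    rw [lt_div_iff₀ hδ0]; nlinarith)
  have hΛ0 : 0 < Λ := Real.log_pos (by
    rw [lt_div_iff₀ hδ0]; nlinarith)
  have hub : ∀ x x', |f x - f x'| ≤ 2 * B := abs_sub_le_of_norm_le hk hf
  obtain ⟨g, hgf, hg⟩ := exists_difference_function hD f
  have hgB := hgf.trans hf
  have hκ4 : ∀ r, 4 ≤ roundCurvature f r := fun r => by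
    rw [roundCurvature]
    split_ifs
    · exact four_le_curvature f
    · norm_num
  have hcκ : ∀ r, c * roundCurvature f r ≤ 1 := fun r => by
    rw [roundCurvature]
    split_ifs
    · have h1 : c ≤ deriv Real.sigmoid (2 * B) := (min_le_left _ _).trans
        (deriv_sigmoid_anti (by rw [abs_of_pos (by linarith)]; linarith))
      have h2 : curvature f ≤ κB := curvature_le f hub
      calc c * curvature f ≤ deriv Real.sigmoid (2 * B) * κB :=
            mul_le_mul h1 h2 (by linarith [four_le_curvature f]) (deriv_sigmoid_pos _).le
        _ = 1 := mul_one_div_cancel (deriv_sigmoid_pos _).ne'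
    · have := min_le_right (deriv Real.sigmoid (2 * B + 1)) (1 / 6)
      linarith
  have hq := realKernel_eq_inner (H := D)
  choose v hv1 hv2 hv3 hv4 using fun (r : ℕ) (pts : Fin (roundSize T r) → X × X) (x : X) =>
    exists_weighted_representer hq hlam
      (show 0 < roundCurvature f r by linarith [hκ4 r]) pts (xstar, x)
      (fun i => deriv Real.sigmoid (g (pts i))) (fun _ => (deriv_sigmoid_pos _).le)
  simp only [inner_kerFun_one] at hv1 hv2 hv3 hv4
  -- The left summand holds the query indicators for the rough estimate, at a generous level that
  -- enters only `K`; the right one holds the representers of the pairs `(xstar, x)`, whose level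
  -- fixes the confidence width.
  have hbad := hM.noise_bound hBTL (ι := (X × X) ⊕ X)
    (fun r k pts i => Sum.elim (fun p => if pts i = p then 1 else 0)
      (fun x => v r pts x (pts i)) k)
    (ℓ := Sum.elim (fun _ => ℓc) (fun _ => 3 / 2 * Λ))
    (by rintro (k | k) <;> simp only [Sum.elim_inl, Sum.elim_inr] <;> positivity)
  rw [Fintype.sum_sum_type] at hbad
  simp only [Sum.elim_inl, Sum.elim_inr, Finset.sum_const, Finset.card_univ, nsmul_eq_mul] at hbad
  refine ofReal_one_sub_le_of_compl_subset
    (hbad.trans (failure_budget hR2' hRT' hp hn hδ0 hδ1)) ?_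
  rw [Set.compl_subset_comm]
  intro ω hω
  simp only [Set.mem_compl_iff, Set.mem_ofPred_eq, not_exists, not_and, not_lt] at hω
  have hcardN : ∀ r, √(T : ℝ) / 2 ≤ roundSize T r → Fintype.card (X × X) * m < roundSize T r :=
    fun r hr => by exact_mod_cast hpm.trans_le hr
  have step : ∀ r, 1 ≤ r → r ≤ R → √(T : ℝ) / 2 ≤ roundSize T r → xstar ∈ M r ω →
      (∀ x ∈ M r ω, ∀ x' ∈ M r ω, 1 / roundCurvature f r ≤ deriv Real.sigmoid (f x - f x')) →
      xstar ∈ M (r + 1) ω ∧ ∀ x ∈ M (r + 1) ω, prefProb f xstar x - 1 / 2 ≤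
        2 * (confWidth f lam B δ T r *
          roundUncertainty (realKernel D) f lam T r (roundSize T r) z ω (xstar, x)) := by
    intro r hr1 hr hN hmem hcurv
    refine hM.elimination hD hr1 hr hstar hmem fun x => ?_
    exact hM.round_error hlam hB hδ0 hδ1 hg hgB hub hr1 hr hR3 ⟨xstar, hmem⟩ hm0 (hcardN r hN)
      (by linarith [hκ4 r]) hc0 (min_le_left _ _) (hcκ r) hℓc0.le
      (by rw [hK, div_mul_cancel₀ _ hc0.ne']) hKm hK2 hcurv
      (fun p => hω r hr1 hr (Sum.inl p)) (hv1 r _ x) (hv3 r _ x) (hv4 r _ x)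
      (hω r hr1 hr (Sum.inr x))
  have hlong : ∀ r, 1 ≤ r → r < R → √(T : ℝ) / 2 ≤ roundSize T r := fun r hr1 hr => by
    have h1 := sqrt_le_roundSize hr1 hr
    have h2 := Real.sqrt_nonneg (T : ℝ)
    linarith
  have hsub : ∀ r, 1 ≤ r → r ≤ R → M (r + 1) ω ⊆ M r ω := fun r hr1 hr => by
    rw [hM.update r hr1 hr ω]
    exact Set.sep_subset _ _
  have hcurv1 : ∀ x ∈ M 1 ω, ∀ x' ∈ M 1 ω,
      1 / roundCurvature f 1 ≤ deriv Real.sigmoid (f x - f x') := fun x _ x' _ => by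
    rw [roundCurvature_one]; exact one_div_curvature_le f x x'
  have hcurv2 : ∀ r, 2 ≤ r → (∀ x ∈ M r ω, prefProb f xstar x - 1 / 2 ≤ 28 / 100) →
      ∀ x ∈ M r ω, ∀ x' ∈ M r ω,
        1 / roundCurvature f r ≤ deriv Real.sigmoid (f x - f x') := by
    intro r hr hclose x hx x' hx'
    rw [roundCurvature_of_two_le _ hr]
    exact one_sixth_le_deriv_sigmoid (hstar x) (hstar x') (hclose x hx) (hclose x' hx')
  have hmem1 : xstar ∈ M 1 ω := by rw [hM.init ω]; exact Set.mem_univ _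
  obtain ⟨hmem2, hclose2⟩ : xstar ∈ M 2 ω ∧ ∀ x ∈ M 2 ω, prefProb f xstar x - 1 / 2 ≤ 28 / 100 := by
    have hN1 := hlong 1 le_rfl (by omega)
    obtain ⟨h1, h2⟩ := step 1 le_rfl (by omega) hN1 hmem1 hcurv1
    refine ⟨h1, fun x hx => (h2 x hx).trans ?_⟩
    have hκ0 : 0 < roundCurvature f 1 := by linarith [hκ4 1]
    have hκle : roundCurvature f 1 ≤ κB := by
      rw [roundCurvature_one]; exact curvature_le f hub
    have h3 := hM.mul_roundUncertainty_sq_le le_rfl (by omega) (w := (xstar, x))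
      ⟨hmem1, hsub 1 le_rfl (by omega) hx⟩ (hcardN 1 hN1) (mul_pos hlam hκ0)
    set s := roundUncertainty (realKernel D) f lam T 1 (roundSize T 1) z ω (xstar, x) with hs
    have hs0 : 0 ≤ s := uncertainty_nonneg _ _ _
    have h4 : √(m : ℝ) * s ≤ √(lam * κB) := by
      refine Real.le_sqrt_of_sq_le ?_
      rw [mul_pow, Real.sq_sqrt hm0'.le]
      exact h3.trans (mul_le_mul_of_nonneg_left hκle hlam.le)
    have h5 : confWidth f lam B δ T 1 ≤
        1 / 4 * (B + √(κB / lam * Real.log (2 * T * Fintype.card X / δ))) := by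
      rw [confWidth, linkSlope_eq]
      gcongr
    have h6 : 0 ≤ B + √(κB / lam * Real.log (2 * T * Fintype.card X / δ)) := by positivity
    have h7 : √(m : ℝ) * (2 * (confWidth f lam B δ T 1 * s)) ≤ √(m : ℝ) * (28 / 100) := by
      calc √(m : ℝ) * (2 * (confWidth f lam B δ T 1 * s))
          = 2 * confWidth f lam B δ T 1 * (√(m : ℝ) * s) := by ring
        _ ≤ 2 * (1 / 4 * (B + √(κB / lam * Real.log (2 * T * Fintype.card X / δ)))) *
              √(lam * κB) := by
            refine mul_le_mul (mul_le_mul_of_nonneg_left h5 (by norm_num)) h4 (by positivity)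
              (by positivity)
        _ ≤ √(m : ℝ) * (28 / 100) := by linarith
    exact le_of_mul_le_mul_left h7 hsm
  have hind : ∀ r, 2 ≤ r → r ≤ R → xstar ∈ M r ω ∧
      ∀ x ∈ M r ω, prefProb f xstar x - 1 / 2 ≤ 28 / 100 := by
    intro r hr
    induction r, hr using Nat.le_induction with
    | base => exact fun _ => ⟨hmem2, hclose2⟩
    | succ r hr ih =>
      intro hrR
      obtain ⟨h1, h2⟩ := ih (by omega)
      refine ⟨(step r (by omega) (by omega) (hlong r (by omega) (by omega)) h1
        (hcurv2 r hr h2)).1, fun x hx => h2 x (hsub r (by omega) (by omega) hx)⟩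
  -- Stated for any later round with enough samples, because the last one may be cut too short for
  -- the confidence bound. The width is the same for all `r ≥ 2`.
  have hfinal : ∀ r, 2 ≤ r → r ≤ R → √(T : ℝ) / 2 ≤ roundSize T r →
      T ≤ R * roundSize T r → ∀ x ∈ M (r + 1) ω, prefProb f xstar x - 1 / 2 ≤
        2 * confWidth f lam B δ T R * constC lam *
          √((R : ℝ) * maxInfoGain (duelingKernel (realKernel H)) (4 * lam) T / (T : ℝ)) := by
    intro r hr2 hr hN hTN x hx
    obtain ⟨h1, h2⟩ := hind r hr2 hr
    have h3 := (step r (by omega) hr hN h1 (hcurv2 r hr2 h2)).2 x hx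
    have h4 := hM.roundUncertainty_le hlam
      (fun p => (hD p p).trans_le (duelingKernel_self_le hk p)) hr2 hr (w := (xstar, x))
      ⟨h1, hsub r (by omega) hr hx⟩ (by omega) hTN
    have e1 : realKernel D = duelingKernel (realKernel H) := funext fun a => funext fun b => hD a b
    have e2 : confWidth f lam B δ T r = confWidth f lam B δ T R := by
      rw [confWidth, confWidth, roundCurvature_of_two_le _ hr2,
        roundCurvature_of_two_le _ (by omega : 2 ≤ R)]
    have h5 : 0 ≤ confWidth f lam B δ T R := by
      rw [confWidth, linkSlope_eq]; positivity
    rw [e2] at h3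
    rw [← e1, mul_assoc (2 * _), mul_assoc 2]
    exact h3.trans (mul_le_mul_of_nonneg_left (mul_le_mul_of_nonneg_left h4 h5) (by norm_num))
  intro xhat hxhat
  -- If round `R - 1` is the long one, the last elimination only shrinks the set and its accuracy is
  -- irrelevant. Otherwise `N_R ≥ T / R ≥ √T / 2`, as the confidence bound requires.
  rcases le_mul_roundSize (T := T) (by omega) with hTN | hTN
  · have h1 := hfinal (R - 1) (by omega) (by omega) (hlong _ (by omega) (by omega)) hTN
    rw [Nat.sub_add_cancel (by omega : 1 ≤ R)] at h1
    exact h1 xhat (hsub R (by omega) le_rfl hxhat)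
  · refine hfinal R (by omega) le_rfl ?_ hTN xhat hxhat
    have h1 : (T : ℝ) ≤ R * roundSize T R := by exact_mod_cast hTN
    have h2 : (R : ℝ) ≤ √(T : ℝ) + 1 := numRounds_le_sqrt T
    have h3 : 1 ≤ √(T : ℝ) := Real.one_le_sqrt.2 hT1
    have h4 : (T : ℝ) = √(T : ℝ) * √(T : ℝ) := (Real.mul_self_sqrt (by linarith)).symm
    have h5 : (0 : ℝ) ≤ roundSize T R := Nat.cast_nonneg _
    have h6 := mul_le_mul_of_nonneg_right (show (R : ℝ) ≤ 2 * √(T : ℝ) by linarith) h5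
    have h7 : √(T : ℝ) * √(T : ℝ) ≤ √(T : ℝ) * (2 * roundSize T R) := by linarith
    have h8 := le_of_mul_le_mul_left h7 (by linarith)
    linarith
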